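/- **Weighted graphs.** A (row-finite) weighted graph $(E,\omega)$ consists of a set $E^0$ of vertices, a set $E^{\mathrm{st}}$ of structured edges, maps $s,r:E^{\mathrm{st}}\to E^0$ with $s^{-1}(v)$ finite for every $v\in E^0$, and a weight map $\omega:E^{\mathrm{st}}\to\{1,2,\dots\}$. Its edges are distinct symbols $\alpha_i$ ($\alpha\in E^{\mathrm{st}}$, $1\le i\le\omega(\alpha)$), with ghost edges $\alpha_i^*$; put $s(\alpha_i)=r(\alpha_i^*)=s(\alpha)$, $r(\alpha_i)=s(\alpha_i^*)=r(\alpha)$ and $s(v)=r(v)=v$ for $v\in E^0$. A vertex $v$ is a sink if $s^{-1}(v)=\emptyset$; otherwise put $\omega(v)=\max\{\omega(\alpha): s(\alpha)=v\}$. A generalised path $p$ is either a single vertex (of length $|p|=0$) or a word $x_1\cdots x_n$, $n\ge 1$, in edges and ghost edges with $r(x_i)=s(x_{i+1})$ for $1\le i<n$ (of length $|p|=n$); its source is $s(x_1)$ and its range is $r(x_n)$. $(E,\omega)$ is an *LV-graph* if $\omega(\alpha)\ge 2$ for all $\alpha\in E^{\mathrm{st}}$; if for every non-sink $v$ at least two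 $\alpha\in s^{-1}(v)$ satisfy $\omega(\alpha)=\omega(v)$; if $E^{\mathrm{st}}\ne\emptyset$; and if any two vertices are joined by a generalised path. **The algebra.** Let $R$ be a unital ring, let $X$ be the set of all vertices, edges and ghost edges, and let $R\langle X\rangle$ be the free $R$-ring on $X$ (the free left $R$-module on the nonempty words over $X$, with $(rp)(tq)=(rt)(pq)$ for $r,t\in R$ and words $p,q$). The weighted Leavitt path algebra is $L=L_R(E,\omega)=R\langle X\rangle/I$, where $I$ is the two-sided ideal and $R$-subbimodule generated by the relations 1. $vw=\delta_{vw}v$ for $v,w\in E^0$; 2. $s(\alpha)\alpha_i=\alpha_i=\alpha_i r(\alpha)$ and $r(\alpha)\alpha_i^*=\alpha_i^*=\alpha_i^*s(\alpha)$ for $\alpha\in E^{\mathrm{st}}$, $1\le i\le\omega(\alpha)$; 3. $\sum_{s(\alpha)=v}\alpha_i\alpha_j^*=\delta_{ij}v$ for every non-sink $v$ and $1\le i,j\le\omega(v)$; 4. $\sum_{1\le i\le\max\{\omega(\alpha),\omega(\beta)\}}\alpha_i^*\beta_i=\delta_{\alpha\beta}r(\alpha)$ for $\alpha,\beta\in E^{\mathrm{st}}$;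 here $\alpha_i$ and $\alpha_i^*$ are read as $0$ when $i>\omega(\alpha)$. **Normal forms.** For every non-sink $v$ fix any $\alpha^v\in E^{\mathrm{st}}$ with $s(\alpha^v)=v$ and $\omega(\alpha^v)=\omega(v)$. A generalised path is *normal* if it contains no subword of the form $\alpha^v_i(\alpha^v_j)^*$ ($v$ a non-sink, $1\le i,j\le\omega(\alpha^v)$) and no subword of the form $\alpha_1^*\beta_1$ ($\alpha,\beta\in E^{\mathrm{st}}$). A normal representative of $a\in L$ is an $R$-linear combination of normal generalised paths in $R\langle X\rangle$ whose class is $a$. When it exists and is unique, it is denoted $\mathrm{NF}(a)$, and $\mathrm{supp}(a)$ is the set of generalised paths occurring in $\mathrm{NF}(a)$ with nonzero coefficient. **Proposition.** Let $(E,\omega)$ be an LV-graph and let $R$ be a (not necessarily commutative) domain. Then every $a\in L_R(E,\omega)$ has exactly one normal representative $\mathrm{NF}(a)$, and the map $$\nu:L_R(E,\omega)\to\mathbb N_0\cup\{-\infty\},\qquad \nu(a)=\max\{|p| : p\in\mathrm{supp}(a)\}\quad(\max\emptyset=-\infty)$$ is a *local valuation* on $L=L_R(E,\omega)$, that is: 1.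 $\nu(a)=-\infty$ if and only if $a=0$; 2. $\nu(a)=0$ if and only if $a\ne 0$ and $\mathrm{supp}(a)\subseteq E^0$; 3. $\nu(a+b)\le\max\{\nu(a),\nu(b)\}$ for all $a,b\in L$; 4. $\nu(ab)=\nu(a)+\nu(b)$ for all $v\in E^0$, $a\in Lv$ and $b\in vL$, where $x+(-\infty)=(-\infty)+x=-\infty$. -/

import Mathlib

noncomputable section

universe u v w

/-- A row-finite weighted graph with vertex set `V` and set of structured edges `S`.
A structured edge `α` carries the edges `α_1, …, α_{ω(α)}`. -/
structure WeightedGraph (V : Type u) (S : Type v) where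
  src : S → V
  tgt : S → V
  weight : S → ℕ
  weight_pos : ∀ α, 0 < weight α
  rowFinite : ∀ x : V, {α : S | src α = x}.Finite

namespace WeightedGraph

variable {V : Type u} {S : Type v} (E : WeightedGraph V S)

/-- The finite set of structured edges with source `x`. -/
def outEdges (x : V) : Finset S := (E.rowFinite x).toFinset

/-- `x` is not a sink. -/
def NotSink (x : V) : Prop := ∃ α : S, E.src α = x

/-- The weight of a vertex, `max {ω(α) | s(α) = x}` (only meaningful when `x` is not a sink;
it is `0` for a sink). -/
def vertexWeight (x : V) : ℕ := (E.outEdges x).sup E.weight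

/-- The alphabet consisting of the vertices, the edges `α_i` and the ghost edges `α_i^*`.
Indices are shifted by one: `i : Fin (ω α)` stands for the index `i + 1`. -/
inductive Letter (E : WeightedGraph V S) : Type (max u v)
  | vertex (x : V) : Letter E
  | edge (α : S) (i : Fin (E.weight α)) : Letter E
  | ghost (α : S) (i : Fin (E.weight α)) : Letter E

variable {E} in
/-- Source of a letter. -/
def Letter.src : Letter E → V
  | .vertex x => x
  | .edge α _ => E.src α
  | .ghost α _ => E.tgt α

variable {E} in
/-- Range of a letter. -/
def Letter.tgt : Letter E → V
  | .vertex x => x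
  | .edge α _ => E.tgt α
  | .ghost α _ => E.src α

variable {E} in
/-- The letter is a vertex. -/
def Letter.IsVertex (x : Letter E) : Prop := ∃ y : V, x = .vertex y

/-- The nonempty words over the alphabet. -/
abbrev Word := FreeSemigroup E.Letter

variable {E} in
/-- The list of letters of a word. -/
def Word.letters (p : E.Word) : List E.Letter := p.head :: p.tail

variable {E} in
/-- Source of a word: source of its first letter. -/
def Word.src (p : E.Word) : V := p.head.src

variable {E} in
/-- Range of a word: range of its last letter. -/
def Word.tgt (p : E.Word) : V := (p.letters.getLast (List.cons_ne_nil _ _)).tgt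

variable {E} in
/-- The word consists of a single letter, which is a vertex. -/
def Word.IsTrivial (p : E.Word) : Prop := ∃ x : V, p = FreeSemigroup.of (.vertex x)

variable {E} in
/-- Generalised paths: single vertices, and words `x_1 … x_n` in the edges and ghost edges with
`r(x_i) = s(x_{i+1})`. -/
def Word.IsGenPath (p : E.Word) : Prop :=
  p.IsTrivial ∨
    ((∀ x ∈ p.letters, ¬ x.IsVertex) ∧ p.letters.IsChain (fun x y => x.tgt = y.src))

variable {E} in
open Classical in
/-- The length of a generalised path: `0` for a vertex, the number of letters otherwise. -/
def Word.pathLength (p : E.Word) : ℕ := if p.IsTrivial then 0 else p.letters.length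

/-- There is exactly one connected component: there is a vertex, and any two vertices are joined
by a generalised path. -/
def IsConnected : Prop :=
  Nonempty V ∧ ∀ x y : V, ∃ p : E.Word, p.IsGenPath ∧ p.src = x ∧ p.tgt = y

/-- LV-graphs. -/
structure IsLV : Prop where
  two_le_weight : ∀ α : S, 2 ≤ E.weight α
  two_le_card : ∀ x : V, E.NotSink x →
    2 ≤ ((E.outEdges x).filter (fun α => E.weight α = E.vertexWeight x)).card
  nonempty_edges : Nonempty S
  connected : E.IsConnected

/-- A choice, for each vertex `x` that is not a sink, of a structured edge `α^x` with source `x`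
and of maximal weight among the structured edges with source `x`. -/
structure SpecialEdges where
  edge : {x : V // E.NotSink x} → S
  src_edge : ∀ x, E.src (edge x) = x.1
  weight_edge : ∀ x, E.weight (edge x) = E.vertexWeight x.1

variable {E} in
/-- Words of type I: `α^x_i (α^x_j)^*`. -/
def Word.IsTypeI (c : E.SpecialEdges) (p : E.Word) : Prop :=
  ∃ (x : {x : V // E.NotSink x}) (i j : Fin (E.weight (c.edge x))),
    p = FreeSemigroup.of (.edge (c.edge x) i) * FreeSemigroup.of (.ghost (c.edge x) j)

variable {E} in
/-- Words of type II: `α_1^* β_1`. -/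
def Word.IsTypeII (p : E.Word) : Prop :=
  ∃ α β : S, p = FreeSemigroup.of (.ghost α ⟨0, E.weight_pos α⟩) *
    FreeSemigroup.of (.edge β ⟨0, E.weight_pos β⟩)

variable {E} in
/-- Normal generalised paths: those without subwords of type I or II. -/
def Word.IsNormal (c : E.SpecialEdges) (p : E.Word) : Prop :=
  p.IsGenPath ∧
    ∀ q : E.Word, q.IsTypeI c ∨ q.IsTypeII → ¬ q.letters <:+: p.letters

variable (R : Type w) [Ring R]

/-- The free (non-unital) `R`-ring on the alphabet: the free left `R`-module on the nonempty words
with `(r p) (s q) = (r s) (p q)`. -/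
abbrev FreeRing := MonoidAlgebra R E.Word

/-- A word as an element of the free `R`-ring. -/
def word (p : E.Word) : E.FreeRing R := MonoidAlgebra.single p 1

/-- A vertex as an element of the free `R`-ring. -/
def vertexElt (x : V) : E.FreeRing R := E.word R (FreeSemigroup.of (.vertex x))

/-- `edgeElt α i` is `α_{i+1}`, understood to be zero if `i + 1 > ω(α)`. -/
def edgeElt (α : S) (i : ℕ) : E.FreeRing R :=
  if h : i < E.weight α then E.word R (FreeSemigroup.of (.edge α ⟨i, h⟩)) else 0

/-- `ghostElt α i` is `α_{i+1}^*`, understood to be zero if `i + 1 > ω(α)`. -/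
def ghostElt (α : S) (i : ℕ) : E.FreeRing R :=
  if h : i < E.weight α then E.word R (FreeSemigroup.of (.ghost α ⟨i, h⟩)) else 0

open Classical in
/-- The defining relations: `Rel a b` stands for the relation `a = b`. -/
inductive Rel : E.FreeRing R → E.FreeRing R → Prop
  | vertex_mul (x y : V) :
      Rel (E.vertexElt R x * E.vertexElt R y) (if x = y then E.vertexElt R x else 0)
  | src_mul_edge (α : S) (i : ℕ) (hi : i < E.weight α) :
      Rel (E.vertexElt R (E.src α) * E.edgeElt R α i) (E.edgeElt R α i)
  | edge_mul_tgt (α : S) (i : ℕ) (hi : i < E.weight α) :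
      Rel (E.edgeElt R α i * E.vertexElt R (E.tgt α)) (E.edgeElt R α i)
  | tgt_mul_ghost (α : S) (i : ℕ) (hi : i < E.weight α) :
      Rel (E.vertexElt R (E.tgt α) * E.ghostElt R α i) (E.ghostElt R α i)
  | ghost_mul_src (α : S) (i : ℕ) (hi : i < E.weight α) :
      Rel (E.ghostElt R α i * E.vertexElt R (E.src α)) (E.ghostElt R α i)
  | sum_edge_mul_ghost (x : V) (i j : ℕ) (hi : i < E.vertexWeight x)
      (hj : j < E.vertexWeight x) :
      Rel (∑ α ∈ E.outEdges x, E.edgeElt R α i * E.ghostElt R α j)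
        (if i = j then E.vertexElt R x else 0)
  | sum_ghost_mul_edge (α β : S) :
      Rel (∑ i ∈ Finset.range (max (E.weight α) (E.weight β)),
          E.ghostElt R α i * E.edgeElt R β i)
        (if α = β then E.vertexElt R (E.tgt α) else 0)

/-- The ideal of the free `R`-ring generated by the defining relations: the smallest two-sided
ideal that is an `R`-subbimodule and contains `a - b` for every relation `a = b`. -/
def relIdeal : TwoSidedIdeal (E.FreeRing R) :=
  sInf {J | (∀ (r : R), ∀ a ∈ J, r • a ∈ J ∧ MulOpposite.op r • a ∈ J) ∧
    ∀ a b, E.Rel R a b → a - b ∈ J}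

/-- The weighted Leavitt path algebra `L_R(E, ω)`, as a non-unital ring. -/
abbrev LPA := (E.relIdeal R).ringCon.Quotient

/-- The quotient map from the free `R`-ring to the weighted Leavitt path algebra. -/
def toLPA (f : E.FreeRing R) : E.LPA R := (f : (E.relIdeal R).ringCon.Quotient)

/-- A vertex as an element of the weighted Leavitt path algebra. -/
def vertexLPA (x : V) : E.LPA R := E.toLPA R (E.vertexElt R x)

variable {E R}

/-- Normal elements of the free `R`-ring: linear combinations of normal generalised paths. -/
def IsNormalElt (c : E.SpecialEdges) (f : E.FreeRing R) : Prop :=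
  ∀ p ∈ f.coeff.support, p.IsNormal c

/-- `f` is a normal representative of `a`. -/
def IsNormalRep (c : E.SpecialEdges) (a : E.LPA R) (f : E.FreeRing R) : Prop :=
  IsNormalElt c f ∧ E.toLPA R f = a

open Classical in
/-- The normal form of `a`: its (unique) normal representative. The value `0` is taken if there is
no normal representative. -/
def NF (c : E.SpecialEdges) (a : E.LPA R) : E.FreeRing R :=
  if h : ∃ f, IsNormalRep c a f then h.choose else 0

/-- The support of `a`: the words occurring in the normal form of `a`. -/
def supp (c : E.SpecialEdges) (a : E.LPA R) : Finset E.Word := (NF c a).coeff.support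

/-- Local valuations on the weighted Leavitt path algebra; `⊥ : WithBot ℕ` is `-∞`. -/
structure IsLocalValuation (c : E.SpecialEdges) (ν : E.LPA R → WithBot ℕ) : Prop where
  eq_bot_iff : ∀ a, ν a = ⊥ ↔ a = 0
  eq_zero_iff : ∀ a, ν a = 0 ↔ a ≠ 0 ∧ ∀ p ∈ supp c a, p.IsTrivial
  add_le : ∀ a b, ν (a + b) ≤ max (ν a) (ν b)
  mul_eq : ∀ (x : V) (a b : E.LPA R), (∃ a', a = a' * E.vertexLPA R x) →
    (∃ b', b = E.vertexLPA R x * b') → ν (a * b) = ν a + ν b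

/-- The maximal length of a path in the support of `a`, with `max ∅ = -∞`. -/
def maxLength (c : E.SpecialEdges) (a : E.LPA R) : WithBot ℕ :=
  (supp c a).sup (fun p => (p.pathLength : WithBot ℕ))

end WeightedGraph

end

noncomputable section

open scoped Classical

namespace WeightedGraph

universe u v w

/-! Relations 3 and 4 are read as rewriting rules (indices from 1, as on paper). Rule I turns `α_i
α_j^*`, with α the special edge at v, into `δ_ij v` minus the sum of `γ_i γ_j^*` over the other
edges γ leaving v. Rule II turns `α_1^* β_1` into `δ_αβ r(α)` minus the sum of `α_k^* β_k` over k ≥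
2. Normal paths are the irreducible ones.

Everything rests on one observation. Whether a letter forms a bad junction with its outer neighbour
depends, for the two letters in rule I, only on their indices, and for those in rule II, only on
their structured edges; exactly these data survive the rewriting. So a rewritten junction of two
normal paths needs no second rewriting in top length (`topPart_mem_of_prefix`).

Existence: the span of the normal paths is stable under left multiplication by letters, with an
explicit formula (`letterMul_mem`, `letterLPA_mul_listLPA`). Uniqueness: the same formula defines
operators on that span, and these satisfy the defining relations (`act_eq_of_rel`). The real content
is the resolution of the overlaps `α_i α_1^* β_1` and `α_i^* β_i β_j^*` in `sum_edgeEnd_ghostEnd`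
and `sum_ghostEnd_edgeEnd`. Hence L acts there, and a normal element applied to trivial paths
returns its own coefficients (`actToFree_nil`).

Valuation: let m, n be combinations of normal paths and let Py, zQ be longest paths in them. The
coefficient of `P z₁ z₂ Q` in the product is `m(P z₁) n(z₂ Q)`, minus `m(P z₁') n(z₂' Q)` if the
normal pair `z₁ z₂` is produced from a (then unique) bad pair `z₁' z₂'` (`actToFree_apply`). If all
of these vanished, a bad pair and every pair it produces would carry equal products, and a normal
pair that is not produced would carry the product zero. The LV condition makes every bad pair
produce at least one pair: through a second edge of maximal weight for rule I, through index 2 for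
rule II. Mixing the first letter of one pair with the second letter of the other yields a normal
pair that no rule produces, yet whose product is nonzero because R is a domain
(`exists_actToFree_apply_ne_zero`). -/

variable {V : Type u} {S : Type v} {E : WeightedGraph V S}

/-! ### Normal paths as lists with a range, and the rewriting rules as operators -/

/-- A special structured edge is one of the chosen edges `α^x`. -/
def SpecialEdges.IsSpecial (c : E.SpecialEdges) (α : S) : Prop := ∃ x, c.edge x = α

/-- Junctions of two letters that are not allowed in a normal path. -/
def Letter.IsBad (c : E.SpecialEdges) : E.Letter → E.Letter → Prop
  | .edge α _, .ghost β _ => α = β ∧ c.IsSpecial α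
  | .ghost _ i, .edge _ j => i.val = 0 ∧ j.val = 0
  | _, _ => False

/-- Source of the list `l` of letters, which is regarded as a path with range `x`. -/
def listSrc : List E.Letter → V → V
  | [], x => x
  | y :: _, _ => y.src

/-- The list `l` of letters is a normal generalised path with range `x`. -/
def NormalList (c : E.SpecialEdges) : List E.Letter → V → Prop
  | [], _ => True
  | y :: l, x => ¬ y.IsVertex ∧ y.tgt = listSrc l x ∧ (∀ z ∈ l.head?, ¬ y.IsBad c z) ∧
      NormalList c l x

variable (E) in
/-- The free left module on the lists of letters with a prescribed range. -/
abbrev ListModule (R : Type w) [Ring R] := List E.Letter × V →₀ R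

variable (c : E.SpecialEdges) (R : Type w) [Ring R]

/-- A list with range `x` as a basis element. -/
def listElt (l : List E.Letter) (x : V) : E.ListModule R := Finsupp.single (l, x) 1

/-- Prefixing a list. -/
def prefixMap (l : List E.Letter) : E.ListModule R →ₗ[R] E.ListModule R :=
  Finsupp.lmapDomain R R (fun p => (l ++ p.1, p.2))

/-- Prefixing the edge `α_{i+1}`, with value zero if `i + 1 > ω(α)`. -/
def consEdge (α : S) (i : ℕ) : E.ListModule R →ₗ[R] E.ListModule R :=
  if h : i < E.weight α then prefixMap R [.edge α ⟨i, h⟩] else 0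

/-- Prefixing the ghost edge `α_{i+1}^*`, with value zero if `i + 1 > ω(α)`. -/
def consGhost (α : S) (i : ℕ) : E.ListModule R →ₗ[R] E.ListModule R :=
  if h : i < E.weight α then prefixMap R [.ghost α ⟨i, h⟩] else 0

/-- The part of maximal length of the product of an edge with a list. -/
def topPart : E.Letter → List E.Letter → V → E.ListModule R
  | .edge α i, .ghost β j :: l, x =>
      if α = β ∧ c.IsSpecial α then
        - ∑ γ ∈ (E.outEdges (E.src α)).erase α, consEdge R γ i (consGhost R γ j (listElt R l x))
      else listElt R (.edge α i :: .ghost β j :: l) x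
  | .ghost α i, .edge β j :: l, x =>
      if i.val = 0 ∧ j.val = 0 then
        - ∑ k ∈ Finset.Ico 1 (E.weight α), consGhost R α k (consEdge R β k (listElt R l x))
      else listElt R (.ghost α i :: .edge β j :: l) x
  | y, l, x => listElt R (y :: l) x

/-- The remaining part of the product of an edge with a list. -/
def lowPart : E.Letter → List E.Letter → V → E.ListModule R
  | .edge α i, .ghost β j :: l, x =>
      if (α = β ∧ c.IsSpecial α) ∧ i.val = j.val then listElt R l x else 0
  | .ghost α i, .edge β j :: l, x =>
      if (i.val = 0 ∧ j.val = 0) ∧ α = β then listElt R l x else 0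
  | _, _, _ => 0

/-- The product of a letter with a list, in normal form. -/
def letterMul : E.Letter → List E.Letter → V → E.ListModule R
  | .vertex y, l, x => if listSrc l x = y then listElt R l x else 0
  | y, l, x => if listSrc l x = y.tgt then lowPart c R y l x + topPart c R y l x else 0

/-- Left multiplication with a letter, as an endomorphism. -/
def letterEnd (y : E.Letter) : E.ListModule R →ₗ[R] E.ListModule R :=
  Finsupp.linearCombination R (fun p => letterMul c R y p.1 p.2)

/-- Left multiplication with `α_{i+1}`. -/
def edgeEnd (α : S) (i : ℕ) : E.ListModule R →ₗ[R] E.ListModule R :=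
  if h : i < E.weight α then letterEnd c R (.edge α ⟨i, h⟩) else 0

/-- Left multiplication with `α_{i+1}^*`. -/
def ghostEnd (α : S) (i : ℕ) : E.ListModule R →ₗ[R] E.ListModule R :=
  if h : i < E.weight α then letterEnd c R (.ghost α ⟨i, h⟩) else 0

variable {c R}

/-! ### Formulas for the letter operators -/

lemma mem_outEdges {α : S} {x : V} : α ∈ E.outEdges x ↔ E.src α = x := by
  simp [outEdges]

lemma weight_le_vertexWeight {α : S} {x : V} (h : E.src α = x) :
    E.weight α ≤ E.vertexWeight x := Finset.le_sup (f := E.weight) (mem_outEdges.2 h)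

lemma SpecialEdges.IsSpecial.eq_of_src_eq {α β : S} (hα : c.IsSpecial α) (hβ : c.IsSpecial β)
    (h : E.src α = E.src β) : α = β := by
  obtain ⟨⟨x, hx⟩, rfl⟩ := hα
  obtain ⟨⟨y, hy⟩, rfl⟩ := hβ
  rw [c.src_edge, c.src_edge] at h
  subst h; rfl

lemma SpecialEdges.IsSpecial.weight_eq {α : S} (hα : c.IsSpecial α) :
    E.weight α = E.vertexWeight (E.src α) := by
  obtain ⟨x, rfl⟩ := hα
  rw [c.weight_edge, c.src_edge]

lemma exists_isSpecial (c : E.SpecialEdges) (α : S) : ∃ β, c.IsSpecial β ∧ E.src β = E.src α :=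
  ⟨_, ⟨⟨E.src α, α, rfl⟩, rfl⟩, c.src_edge _⟩

@[simp] lemma prefixMap_listElt (l l' : List E.Letter) (x : V) :
    prefixMap R l (listElt R l' x) = listElt R (l ++ l') x := by
  simp [prefixMap, listElt, Finsupp.mapDomain_single]

lemma consEdge_of_lt {α : S} {i : ℕ} (h : i < E.weight α) (l : List E.Letter) (x : V) :
    consEdge R α i (listElt R l x) = listElt R (.edge α ⟨i, h⟩ :: l) x := by
  simp [consEdge, h]

lemma consGhost_of_lt {α : S} {i : ℕ} (h : i < E.weight α) (l : List E.Letter) (x : V) :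
    consGhost R α i (listElt R l x) = listElt R (.ghost α ⟨i, h⟩ :: l) x := by
  simp [consGhost, h]

lemma consEdge_of_le {α : S} {i : ℕ} (h : E.weight α ≤ i) : consEdge (E := E) R α i = 0 := by
  simp [consEdge, h]

lemma consGhost_of_le {α : S} {i : ℕ} (h : E.weight α ≤ i) : consGhost (E := E) R α i = 0 := by
  simp [consGhost, h]

lemma edgeEnd_of_le {α : S} {i : ℕ} (h : E.weight α ≤ i) : edgeEnd c R α i = 0 := by
  simp [edgeEnd, h]

lemma ghostEnd_of_le {α : S} {i : ℕ} (h : E.weight α ≤ i) : ghostEnd c R α i = 0 := by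
  simp [ghostEnd, h]

@[simp] lemma letterEnd_listElt (y : E.Letter) (l : List E.Letter) (x : V) :
    letterEnd c R y (listElt R l x) = letterMul c R y l x := by
  simp [letterEnd, listElt]

lemma edgeEnd_of_ne {α : S} {l : List E.Letter} {x : V} (i : ℕ) (h : listSrc l x ≠ E.tgt α) :
    edgeEnd c R α i (listElt R l x) = 0 := by
  unfold edgeEnd
  split_ifs
  · rw [letterEnd_listElt, letterMul]
    · exact if_neg h
    · rintro _ ⟨⟩
  · rfl

lemma ghostEnd_of_ne {α : S} {l : List E.Letter} {x : V} (i : ℕ) (h : listSrc l x ≠ E.src α) :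
    ghostEnd c R α i (listElt R l x) = 0 := by
  unfold ghostEnd
  split_ifs
  · rw [letterEnd_listElt, letterMul]
    · exact if_neg h
    · rintro _ ⟨⟩
  · rfl

lemma topPart_of_not_isBad {y : E.Letter} {l : List E.Letter} (x : V)
    (h : ∀ z ∈ l.head?, ¬ y.IsBad c z) : topPart c R y l x = listElt R (y :: l) x := by
  unfold topPart
  split
  · rw [if_neg]; simpa [Letter.IsBad] using h
  · rw [if_neg]; simpa [Letter.IsBad] using h
  · rfl

lemma lowPart_of_not_isBad {y : E.Letter} {l : List E.Letter} (x : V)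
    (h : ∀ z ∈ l.head?, ¬ y.IsBad c z) : lowPart c R y l x = 0 := by
  unfold lowPart
  split
  · rw [if_neg]; intro h'; exact h _ rfl h'.1
  · rw [if_neg]; intro h'; exact h _ rfl h'.1
  · rfl

lemma letterMul_of_not_isVertex {y : E.Letter} (hy : ¬ y.IsVertex) {l : List E.Letter} {x : V}
    (h : y.tgt = listSrc l x) : letterMul c R y l x = lowPart c R y l x + topPart c R y l x := by
  cases y with
  | vertex z => exact (hy ⟨z, rfl⟩).elim
  | edge α i =>
    rw [letterMul, if_pos h.symm]
    rintro _ ⟨⟩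
  | ghost α i =>
    rw [letterMul, if_pos h.symm]
    rintro _ ⟨⟩

lemma letterMul_of_not_isBad {y : E.Letter} (hy : ¬ y.IsVertex) {l : List E.Letter} {x : V}
    (h : y.tgt = listSrc l x) (hb : ∀ z ∈ l.head?, ¬ y.IsBad c z) :
    letterMul c R y l x = listElt R (y :: l) x := by
  rw [letterMul_of_not_isVertex hy h, lowPart_of_not_isBad x hb, topPart_of_not_isBad x hb,
    zero_add]

lemma edgeEnd_of_not_isBad {α : S} {l : List E.Letter} {x : V} (i : ℕ)
    (h : E.tgt α = listSrc l x) (hb : ∀ (k : Fin (E.weight α)), ∀ z ∈ l.head?,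
      ¬ Letter.IsBad c (.edge α k) z) :
    edgeEnd c R α i (listElt R l x) = consEdge R α i (listElt R l x) := by
  by_cases hi : i < E.weight α
  · rw [consEdge_of_lt hi, edgeEnd, dif_pos hi, letterEnd_listElt]
    exact letterMul_of_not_isBad (by rintro ⟨_, ⟨⟩⟩) h (hb _)
  · rw [edgeEnd_of_le (not_lt.1 hi), consEdge_of_le (not_lt.1 hi)]

lemma ghostEnd_of_not_isBad {α : S} {l : List E.Letter} {x : V} (i : ℕ)
    (h : E.src α = listSrc l x) (hb : ∀ (k : Fin (E.weight α)), k.val = i → ∀ z ∈ l.head?,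
      ¬ Letter.IsBad c (.ghost α k) z) :
    ghostEnd c R α i (listElt R l x) = consGhost R α i (listElt R l x) := by
  by_cases hi : i < E.weight α
  · rw [consGhost_of_lt hi, ghostEnd, dif_pos hi, letterEnd_listElt]
    exact letterMul_of_not_isBad (by rintro ⟨_, ⟨⟩⟩) h (hb ⟨i, hi⟩ rfl)
  · rw [ghostEnd_of_le (not_lt.1 hi), consGhost_of_le (not_lt.1 hi)]

/-- No bound on `i` is needed: a special edge has the largest weight at its source, so for `i`
beyond it every term on both sides is zero. -/
lemma edgeEnd_consGhost_of_isSpecial {α : S} (hα : c.IsSpecial α) (i : ℕ) {j : ℕ}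
    (hj : j < E.weight α) (l : List E.Letter) (x : V) :
    edgeEnd c R α i (consGhost R α j (listElt R l x)) = (if i = j then listElt R l x else 0) -
      ∑ γ ∈ (E.outEdges (E.src α)).erase α, consEdge R γ i (consGhost R γ j (listElt R l x)) := by
  by_cases hi : i < E.weight α
  · rw [consGhost_of_lt hj, edgeEnd, dif_pos hi, letterEnd_listElt, letterMul_of_not_isVertex]
    · simp [lowPart, topPart, hα, sub_eq_add_neg]
    · rintro ⟨_, h⟩; cases h
    · rfl
  · rw [edgeEnd_of_le (not_lt.1 hi), if_neg (by omega), Finset.sum_eq_zero]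
    · simp
    · intro γ hγ
      rw [Finset.mem_erase, mem_outEdges] at hγ
      have := weight_le_vertexWeight hγ.2
      rw [← hα.weight_eq] at this
      rw [consEdge_of_le (by omega)]
      rfl

lemma ghostEnd_consEdge_zero {α β : S} (h : E.src α = E.src β) (l : List E.Letter) (x : V) :
    ghostEnd c R α 0 (consEdge R β 0 (listElt R l x)) = (if α = β then listElt R l x else 0) -
      ∑ k ∈ Finset.Ico 1 (E.weight α), consGhost R α k (consEdge R β k (listElt R l x)) := by
  rw [consEdge_of_lt (E.weight_pos β), ghostEnd, dif_pos (E.weight_pos α), letterEnd_listElt,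
    letterMul_of_not_isVertex]
  · simp [lowPart, topPart, sub_eq_add_neg]
  · rintro ⟨_, h⟩; cases h
  · exact h

/-! ### The operators satisfy relations 3 and 4 on normal lists -/

/-- Only the summand of the special edge is rewritten, and its correction terms cancel all the other
summands. -/
lemma sum_edgeEnd_consGhost (x : V) {i j : ℕ} (hi : i < E.vertexWeight x)
    (hj : j < E.vertexWeight x) (l : List E.Letter) (y : V) :
    ∑ α ∈ E.outEdges x, edgeEnd c R α i (consGhost R α j (listElt R l y)) =
      if i = j then listElt R l y else 0 := by
  obtain ⟨α₀, hα₀⟩ : E.NotSink x := by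
    by_contra h
    have : E.outEdges x = ∅ :=
      Finset.eq_empty_of_forall_notMem fun α hα => h ⟨α, mem_outEdges.1 hα⟩
    simp [vertexWeight, this] at hi
  obtain ⟨α, hα, hαx⟩ := exists_isSpecial c α₀
  rw [hα₀] at hαx
  rw [← Finset.add_sum_erase _ _ (mem_outEdges.2 hαx),
    edgeEnd_consGhost_of_isSpecial hα i (by rwa [hα.weight_eq, hαx]), hαx, sub_add,
    sub_eq_self, sub_eq_zero]
  refine Finset.sum_congr rfl fun γ hγ => ?_
  rw [Finset.mem_erase, mem_outEdges] at hγ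
  by_cases hjγ : j < E.weight γ
  · rw [consGhost_of_lt hjγ, edgeEnd_of_not_isBad]
    · rfl
    · rintro k z hz hb
      simp only [List.head?_cons, Option.mem_def, Option.some.injEq] at hz
      subst hz
      obtain ⟨-, h⟩ := hb
      exact hγ.1 (h.eq_of_src_eq hα (hγ.2.trans hαx.symm))
  · rw [consGhost_of_le (not_lt.1 hjγ)]; simp

/-- For equal sources only the summand with index `0` is rewritten, and its correction terms cancel
the rest. For different sources every summand is zero. -/
lemma sum_ghostEnd_consEdge (α β : S) {N : ℕ} (hN : E.weight α ≤ N) (l : List E.Letter) (y : V) :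
    ∑ i ∈ Finset.range N, ghostEnd c R α i (consEdge R β i (listElt R l y)) =
      if α = β then listElt R l y else 0 := by
  by_cases h : E.src α = E.src β
  · have h1 : 0 < E.weight α := E.weight_pos α
    rw [← Finset.sum_subset (Finset.range_mono hN), Finset.range_eq_Ico,
      Finset.sum_eq_sum_Ico_succ_bot h1, ghostEnd_consEdge_zero h, sub_add, sub_eq_self, sub_eq_zero]
    · refine Finset.sum_congr rfl fun k hk => ?_
      by_cases hk' : k < E.weight β
      · rw [consEdge_of_lt hk', ghostEnd_of_not_isBad]
        · exact h
        · rintro k' rfl z hz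
          simp only [List.head?_cons, Option.mem_def, Option.some.injEq] at hz
          subst hz
          rintro ⟨h3, h4⟩
          simp at hk; omega
      · rw [consEdge_of_le (not_lt.1 hk')]; simp
    · intro i _ hi
      rw [ghostEnd_of_le (by simpa using hi)]; rfl
  · rw [if_neg (by rintro rfl; exact h rfl), Finset.sum_eq_zero]
    intro i _
    by_cases hi : i < E.weight β
    · rw [consEdge_of_lt hi, ghostEnd_of_ne]
      exact fun h' => h h'.symm
    · rw [consEdge_of_le (not_lt.1 hi)]; simp

/-- Resolves the overlap of an edge, a ghost edge and an edge: when the ghost edges rewrite against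
the first letter of `l`, rule II is applied first, and the sum over `α` then collapses by
`sum_edgeEnd_consGhost`. -/
lemma sum_edgeEnd_ghostEnd (x : V) {i j : ℕ} (hi : i < E.vertexWeight x)
    (hj : j < E.vertexWeight x) {l : List E.Letter} {y : V} (hl : NormalList c l y) :
    ∑ α ∈ E.outEdges x, edgeEnd c R α i (ghostEnd c R α j (listElt R l y)) =
      if i = j then letterEnd c R (.vertex x) (listElt R l y) else 0 := by
  rw [letterEnd_listElt, letterMul]
  by_cases hx : listSrc l y = x
  swap
  · rw [if_neg hx, ite_self, Finset.sum_eq_zero]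
    intro α hα
    rw [ghostEnd_of_ne _ (by rwa [mem_outEdges.1 hα]), map_zero]
  rw [if_pos hx]
  -- The condition does not involve `α`: either all the ghost edges in the sum rewrite against `l`,
  -- or none does.
  by_cases hb : ∃ (β : S) (k : Fin (E.weight β)), .edge β k ∈ l.head? ∧ j = 0 ∧ k.val = 0
  swap
  · rw [← sum_edgeEnd_consGhost (c := c) x hi hj]
    refine Finset.sum_congr rfl fun α hα => ?_
    rw [ghostEnd_of_not_isBad]
    · rw [hx, mem_outEdges.1 hα]
    · rintro k rfl z hz hkz
      cases z with
      | vertex z => exact hkz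
      | edge β k' => exact hb ⟨β, k', hz, hkz⟩
      | ghost β k' => exact hkz
  obtain ⟨β, k, hk, rfl, hk0⟩ := hb
  obtain ⟨l, rfl⟩ : ∃ l', l = .edge β k :: l' := by
    cases l with
    | nil => simp at hk
    | cons z l => simp at hk; exact ⟨l, by rw [hk]⟩
  obtain rfl : k = ⟨0, E.weight_pos β⟩ := Fin.ext hk0
  obtain ⟨-, hl1, hl2, hl⟩ := hl
  replace hx : E.src β = x := hx
  -- An edge before a ghost edge is bad or not regardless of its index, so any `β_i` may precede the
  -- tail, since `β_0` does.
  have key : edgeEnd c R β i (listElt R l y) = consEdge R β i (listElt R l y) :=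
    edgeEnd_of_not_isBad _ hl1 fun k z hz hbad => hl2 z hz (by
      cases z <;> exact hbad)
  -- The range of `k` is enlarged from the weight of `α` to that of the vertex by adding zero terms,
  -- so that the sums over `α` and `k` can be exchanged.
  have h1 : ∀ α ∈ E.outEdges x, edgeEnd c R α i (ghostEnd c R α 0
      (listElt R (.edge β ⟨0, E.weight_pos β⟩ :: l) y)) =
      (if α = β then edgeEnd c R α i (listElt R l y) else 0) -
      ∑ k ∈ Finset.Ico 1 (E.vertexWeight x), edgeEnd c R α i
        (consGhost R α k (consEdge R β k (listElt R l y))) := by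
    intro α hα
    rw [mem_outEdges] at hα
    rw [← consEdge_of_lt (E.weight_pos β), ghostEnd_consEdge_zero (hα.trans hx.symm), map_sub,
      map_sum, apply_ite (edgeEnd c R α i), map_zero,
      Finset.sum_subset (Finset.Ico_subset_Ico_right (weight_le_vertexWeight hα))]
    intro k hk hk'
    rw [consGhost_of_le]
    · simp
    · simp at hk hk'; omega
  have h2 : ∀ k ∈ Finset.Ico 1 (E.vertexWeight x), ∑ α ∈ E.outEdges x, edgeEnd c R α i
      (consGhost R α k (consEdge R β k (listElt R l y))) =
      if i = k then consEdge R β k (listElt R l y) else 0 := by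
    intro k hk
    by_cases hkβ : k < E.weight β
    · rw [consEdge_of_lt hkβ, sum_edgeEnd_consGhost x hi (by simp at hk; omega)]
    · rw [consEdge_of_le (not_lt.1 hkβ)]; simp
  rw [Finset.sum_congr rfl h1, Finset.sum_sub_distrib, Finset.sum_comm, Finset.sum_congr rfl h2,
    Finset.sum_ite_eq', if_pos (mem_outEdges.2 hx), Finset.sum_ite_eq, key,
    ← consEdge_of_lt (E.weight_pos β)]
  by_cases h0 : i = 0
  · simp [h0]
  · rw [if_pos (by simp; omega), if_neg h0, sub_self]

/-- Resolves the overlap of a ghost edge, an edge and a ghost edge, in the same way with the roles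
of the two rules exchanged. -/
lemma sum_ghostEnd_edgeEnd (α β : S) {N : ℕ} (hN : E.weight α ≤ N) {l : List E.Letter} {y : V}
    (hl : NormalList c l y) :
    ∑ i ∈ Finset.range N, ghostEnd c R α i (edgeEnd c R β i (listElt R l y)) =
      if α = β then letterEnd c R (.vertex (E.tgt α)) (listElt R l y) else 0 := by
  rw [letterEnd_listElt, letterMul]
  by_cases hx : listSrc l y = E.tgt β
  swap
  · rw [Finset.sum_eq_zero]
    · split_ifs with h1 h2
      · rw [h1] at h2; exact (hx h2).elim
      · rfl
      · rfl
    · intro i _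
      rw [edgeEnd_of_ne _ hx, map_zero]
  have hR : (if α = β then if listSrc l y = E.tgt α then listElt R l y else 0 else 0) =
      if α = β then listElt R l y else 0 := by
    split_ifs with h1 h2
    · rfl
    · rw [h1] at h2; exact (h2 hx).elim
    · rfl
  rw [hR]
  -- Again independent of the summation index `i`.
  by_cases hb : ∃ k : Fin (E.weight β), .ghost β k ∈ l.head? ∧ c.IsSpecial β
  swap
  · rw [← sum_ghostEnd_consEdge (c := c) α β hN]
    refine Finset.sum_congr rfl fun i _ => ?_
    rw [edgeEnd_of_not_isBad _ hx.symm]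
    rintro k z hz hkz
    cases z with
    | vertex z => exact hkz
    | edge β k' => exact hkz
    | ghost γ k' =>
      obtain ⟨rfl, h⟩ := hkz
      exact hb ⟨k', hz, h⟩
  obtain ⟨⟨j, hj⟩, hk, hβ⟩ := hb
  obtain ⟨l, rfl⟩ : ∃ l', l = .ghost β ⟨j, hj⟩ :: l' := by
    cases l with
    | nil => simp at hk
    | cons z l => simp at hk; exact ⟨l, by rw [hk]⟩
  obtain ⟨-, hl1, hl2, hl⟩ := hl
  have h1 : ∀ i ∈ Finset.range N, ghostEnd c R α i (edgeEnd c R β i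
      (listElt R (.ghost β ⟨j, hj⟩ :: l) y)) =
      (if i = j then ghostEnd c R α i (listElt R l y) else 0) -
      ∑ γ ∈ (E.outEdges (E.src β)).erase β, ghostEnd c R α i
        (consEdge R γ i (consGhost R γ j (listElt R l y))) := by
    intro i _
    rw [← consGhost_of_lt hj, edgeEnd_consGhost_of_isSpecial hβ i hj, map_sub, map_sum,
      apply_ite (ghostEnd c R α i), map_zero]
  have h2 : ∀ γ ∈ (E.outEdges (E.src β)).erase β, ∑ i ∈ Finset.range N, ghostEnd c R α i
        (consEdge R γ i (consGhost R γ j (listElt R l y))) =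
      if α = γ then consGhost R γ j (listElt R l y) else 0 := by
    intro γ _
    by_cases hjγ : j < E.weight γ
    · rw [consGhost_of_lt hjγ, sum_ghostEnd_consEdge α γ hN]
    · rw [consGhost_of_le (not_lt.1 hjγ)]; simp
  -- Here `j` is bounded by the weight of `β`, not by `N`; past `N` it exceeds the weight of `α` and
  -- the operator is zero.
  have h3 : (if j ∈ Finset.range N then ghostEnd c R α j (listElt R l y) else 0) =
      ghostEnd c R α j (listElt R l y) := by
    split_ifs with h
    · rfl
    · rw [ghostEnd_of_le (hN.trans (by simpa using h))]; rfl
  rw [Finset.sum_congr rfl h1, Finset.sum_sub_distrib, Finset.sum_comm, Finset.sum_congr rfl h2,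
    Finset.sum_ite_eq', Finset.sum_ite_eq, h3]
  by_cases hs : E.src α = E.src β
  -- A ghost edge before an edge is bad or not according to indices alone, so `α_j^*` may precede
  -- the tail because `β_j^*` does.
  · have key : ghostEnd c R α j (listElt R l y) = consGhost R α j (listElt R l y) :=
      ghostEnd_of_not_isBad _ (hs.trans hl1) fun k hk z hz hbad => hl2 z hz (by
        cases z with
        | vertex z => exact hbad
        | edge γ k' => exact ⟨hk ▸ hbad.1, hbad.2⟩
        | ghost γ k' => exact hbad)
    rw [key]
    by_cases h : α = β
    · subst h
      rw [consGhost_of_lt hj]; simp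
    · simp [h, hs, mem_outEdges]
  · rw [ghostEnd_of_ne _ (fun h => hs (h.symm.trans hl1.symm)), if_neg, if_neg]
    · simp
    · rintro rfl; exact hs rfl
    · simp [mem_outEdges, hs]

/-! ### The span of the normal lists is stable under letters -/

variable (c R) in
/-- The combinations of normal paths of length at most `k`. -/
def normalSubmodule (k : ℕ∞) : Submodule R (E.ListModule R) :=
  Finsupp.supported R R {p | NormalList c p.1 p.2 ∧ (p.1.length : ℕ∞) ≤ k}

lemma listElt_mem_normalSubmodule {l : List E.Letter} {x : V} {k : ℕ∞} (h : NormalList c l x)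
    (hk : (l.length : ℕ∞) ≤ k) : listElt R l x ∈ normalSubmodule c R k :=
  Finsupp.single_mem_supported R 1 ⟨h, hk⟩

lemma normalSubmodule_mono {k k' : ℕ∞} (h : k ≤ k') :
    normalSubmodule c R k ≤ normalSubmodule c R k' :=
  Finsupp.supported_mono fun _ hp => ⟨hp.1, hp.2.trans h⟩

lemma map_mem_of_normalSubmodule {Q : Type*} [AddCommGroup Q] [Module R Q]
    (f : E.ListModule R →ₗ[R] Q) (P : Submodule R Q) (k : ℕ∞)
    (h : ∀ l x, NormalList c l x → (l.length : ℕ∞) ≤ k → f (listElt R l x) ∈ P)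
    {n : E.ListModule R} (hn : n ∈ normalSubmodule c R k) : f n ∈ P := by
  rw [normalSubmodule, Finsupp.supported_eq_span_single] at hn
  refine (Submodule.span_le (p := P.comap f)).2 ?_ hn
  rintro _ ⟨p, hp, rfl⟩
  exact h _ _ hp.1 hp.2

lemma eqOn_normalSubmodule {Q : Type*} [AddCommGroup Q] [Module R Q]
    {f g : E.ListModule R →ₗ[R] Q} {k : ℕ∞}
    (h : ∀ l x, NormalList c l x → f (listElt R l x) = g (listElt R l x))
    {n : E.ListModule R} (hn : n ∈ normalSubmodule c R k) : f n = g n := by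
  have := map_mem_of_normalSubmodule (f - g) ⊥ k (fun l x hl _ => by simp [h l x hl]) hn
  simpa [sub_eq_zero] using this

/-- The bound is not sharp, since a letter of `l` is consumed as well, but it suffices to keep this
part out of the top length. -/
lemma lowPart_mem (y : E.Letter) {l : List E.Letter} {x : V} (hl : NormalList c l x) :
    lowPart c R y l x ∈ normalSubmodule c R l.length := by
  unfold lowPart
  split
  · split_ifs
    · exact listElt_mem_normalSubmodule hl.2.2.2 (by simp)
    · exact zero_mem _
  · split_ifs
    · exact listElt_mem_normalSubmodule hl.2.2.2 (by simp)
    · exact zero_mem _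
  · exact zero_mem _

/-- Normality is a condition on adjacent letters. The new letter `z` has the source of `y` and is no
worse than `y` for a preceding letter, so whatever could precede `y` can precede `z`. -/
lemma NormalList.replace {l₀ l : List E.Letter} {x t : V} {y z : E.Letter}
    (h : NormalList c (l₀ ++ [y]) t) (hzl : NormalList c (z :: l) x) (hs : z.src = y.src)
    (hb : ∀ y', Letter.IsBad c y' z → Letter.IsBad c y' y) : NormalList c (l₀ ++ z :: l) x := by
  induction l₀ with
  | nil => exact hzl
  | cons y' l₀ ih =>
    refine ⟨h.1, ?_, ?_, ih h.2.2.2⟩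
    · cases l₀ with
      | nil => exact h.2.1.trans hs.symm
      | cons => exact h.2.1
    · cases l₀ with
      | nil =>
        intro z' hz' hbad
        cases hz'
        exact h.2.2.1 y rfl (hb _ hbad)
      | cons => exact h.2.2.1

/-- The common source of all statements about the top part: each of its terms stays normal both
behind `l₀` and before the old tail, because rule I keeps indices, rule II keeps structured edges,
and the outer neighbours see nothing else. Stating it for an arbitrary submodule covers normality,
sources and compatibility with prefixes at once. -/
lemma topPart_mem_of_prefix (l₀ : List E.Letter) {y : E.Letter} (hy : ¬ y.IsVertex)
    {l : List E.Letter} {x t : V} (h : y.tgt = listSrc l x) (hl : NormalList c l x)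
    (hl₀ : NormalList c (l₀ ++ [y]) t) (P : Submodule R (E.ListModule R))
    (hP : ∀ l', l'.length = l.length + 1 → listSrc l' x = y.src → NormalList c (l₀ ++ l') x →
      listElt R l' x ∈ P) :
    topPart c R y l x ∈ P := by
  by_cases hb : ∀ z ∈ l.head?, ¬ y.IsBad c z
  · rw [topPart_of_not_isBad x hb]
    exact hP _ rfl rfl (hl₀.replace ⟨hy, h, hb, hl⟩ rfl fun _ => id)
  push Not at hb
  obtain ⟨z, hz, hb⟩ := hb
  obtain ⟨l, rfl⟩ : ∃ l', l = z :: l' := by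
    cases l with
    | nil => simp at hz
    | cons z' l => simp at hz; exact ⟨l, by rw [hz]⟩
  match y, z, hb with
  | .edge α i, .ghost β j, hb =>
    replace hb : α = β ∧ c.IsSpecial α := hb
    rw [topPart, if_pos hb]
    refine neg_mem (sum_mem fun γ hγ => ?_)
    rw [Finset.mem_erase, mem_outEdges] at hγ
    by_cases hj : j.val < E.weight γ
    swap
    · rw [consGhost_of_le (not_lt.1 hj)]; simp
    by_cases hi : i.val < E.weight γ
    swap
    · rw [consEdge_of_le (not_lt.1 hi)]; simp
    rw [consGhost_of_lt hj, consEdge_of_lt hi]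
    refine hP _ rfl hγ.2 (hl₀.replace ⟨?_, rfl, ?_, ?_, ?_, ?_, hl.2.2.2⟩ hγ.2 ?_)
    · rintro ⟨_, ⟨⟩⟩
    · rintro _ ⟨⟩ hbad
      exact hγ.1 (hbad.2.eq_of_src_eq hb.2 hγ.2)
    · rintro ⟨_, ⟨⟩⟩
    · exact hγ.2.trans ((congrArg E.src hb.1).trans hl.2.1)
    · intro z hz hbad
      cases z <;> first | exact hbad | exact hl.2.2.1 _ hz hbad
    · intro y' hbad
      cases y' <;> exact hbad
  | .ghost α i, .edge β j, hb =>
    replace hb : i.val = 0 ∧ j.val = 0 := hb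
    rw [topPart, if_pos hb]
    refine neg_mem (sum_mem fun k hk => ?_)
    rw [Finset.mem_Ico] at hk
    by_cases hj : k < E.weight β
    swap
    · rw [consEdge_of_le (not_lt.1 hj)]; simp
    rw [consEdge_of_lt hj, consGhost_of_lt hk.2]
    refine hP _ rfl rfl (hl₀.replace ⟨?_, h, ?_, ?_, hl.2.1, ?_, hl.2.2.2⟩ rfl ?_)
    · rintro ⟨_, ⟨⟩⟩
    · rintro _ ⟨⟩ hbad
      exact absurd hbad.1 (by simp; omega)
    · rintro ⟨_, ⟨⟩⟩
    · intro z hz hbad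
      cases z <;> first | exact hbad | exact hl.2.2.1 _ hz hbad
    · intro y' hbad
      cases y' <;> exact hbad

lemma letterMul_of_ne {y : E.Letter} {l : List E.Letter} {x : V} (h : listSrc l x ≠ y.tgt) :
    letterMul c R y l x = 0 := by
  cases y with
  | vertex z => exact if_neg h
  | edge α i => rw [letterMul, if_neg h]; rintro _ ⟨⟩
  | ghost α i => rw [letterMul, if_neg h]; rintro _ ⟨⟩

lemma letterMul_mem (y : E.Letter) {l : List E.Letter} {x : V} (hl : NormalList c l x) :
    letterMul c R y l x ∈ normalSubmodule c R (l.length + 1) := by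
  by_cases hy : y.IsVertex
  · obtain ⟨z, rfl⟩ := hy
    rw [letterMul]
    split_ifs
    · exact listElt_mem_normalSubmodule hl (by simp)
    · exact zero_mem _
  by_cases h : y.tgt = listSrc l x
  · rw [letterMul_of_not_isVertex hy h]
    refine add_mem (normalSubmodule_mono (by simp) (lowPart_mem y hl)) ?_
    refine topPart_mem_of_prefix (t := y.tgt) [] hy h hl ?_ _ fun l' h1 _ h2 =>
      listElt_mem_normalSubmodule h2 (by simp [h1])
    exact ⟨hy, rfl, by simp, trivial⟩
  · rw [letterMul_of_ne (Ne.symm h)]; exact zero_mem _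

lemma letterEnd_mem (y : E.Letter) {k : ℕ∞} {n : E.ListModule R}
    (hn : n ∈ normalSubmodule c R k) : letterEnd c R y n ∈ normalSubmodule c R (k + 1) :=
  map_mem_of_normalSubmodule _ _ k (fun l x hl hk => by
    rw [letterEnd_listElt]
    exact normalSubmodule_mono (add_le_add_left hk 1) (letterMul_mem y hl)) hn

/-! ### The action of the free ring factors through the relations -/

variable (c R) in
/-- Left multiplication with a word. -/
def wordEnd : E.Word →ₙ* Module.End R (E.ListModule R) := FreeSemigroup.lift (letterEnd c R)

lemma wordEnd_mem (p : E.Word) {n : E.ListModule R} (hn : n ∈ normalSubmodule c R ⊤) :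
    wordEnd c R p n ∈ normalSubmodule c R ⊤ := by
  induction p using FreeSemigroup.recOnMul generalizing n with
  | ih1 y => exact letterEnd_mem y hn
  | ih2 y p h1 h2 => rw [map_mul]; exact h1 (h2 hn)

variable (c) in
/-- The action of the free ring on combinations of lists. -/
def act (a : E.FreeRing R) (n : E.ListModule R) : E.ListModule R :=
  Finsupp.linearCombination R (fun p => wordEnd c R p n) a.coeff

lemma act_add (a b : E.FreeRing R) (n : E.ListModule R) :
    act c (a + b) n = act c a n + act c b n := by simp [act]

lemma act_smul (r : R) (a : E.FreeRing R) (n : E.ListModule R) :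
    act c (r • a) n = r • act c a n := by simp [act]

lemma act_zero (n : E.ListModule R) : act c 0 n = 0 := by simp [act]

lemma act_sum {ι : Type*} (s : Finset ι) (a : ι → E.FreeRing R) (n : E.ListModule R) :
    act c (∑ i ∈ s, a i) n = ∑ i ∈ s, act c (a i) n := by simp [act]

lemma act_sub (a b : E.FreeRing R) (n : E.ListModule R) :
    act c (a - b) n = act c a n - act c b n := by
  rw [eq_sub_iff_add_eq, ← act_add, sub_add_cancel]

lemma act_single (p : E.Word) (r : R) (n : E.ListModule R) :
    act c (MonoidAlgebra.single p r) n = r • wordEnd c R p n := by simp [act]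

lemma act_word (p : E.Word) (n : E.ListModule R) : act c (E.word R p) n = wordEnd c R p n := by
  simp [word, act_single]

lemma act_apply_add (a : E.FreeRing R) (m n : E.ListModule R) :
    act c a (m + n) = act c a m + act c a n := by
  induction a using MonoidAlgebra.induction_linear with
  | zero => simp [act_zero]
  | add a b ha hb => rw [act_add, act_add, act_add, ha, hb]; abel
  | single p r => simp [act_single]

/-- With noncommutative coefficients the action is not linear in `n`; a scalar moves into the right
action of `R` on the free ring. This makes the annihilator a subbimodule. -/
lemma act_apply_smul (a : E.FreeRing R) (r : R) (n : E.ListModule R) :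
    act c a (r • n) = act c (MulOpposite.op r • a) n := by
  induction a using MonoidAlgebra.induction_linear with
  | zero => simp [act_zero]
  | add a b ha hb => rw [act_add, smul_add, act_add, ha, hb]
  | single p s => simp [act_single, smul_smul]

lemma act_mul (a b : E.FreeRing R) (n : E.ListModule R) :
    act c (a * b) n = act c a (act c b n) := by
  induction a using MonoidAlgebra.induction_linear with
  | zero => simp [act_zero]
  | add a a' ha ha' => rw [add_mul, act_add, act_add, ha, ha']
  | single p r =>
    induction b using MonoidAlgebra.induction_linear with
    | zero => simp [act_zero, act_single]
    | add b b' hb hb' => rw [mul_add, act_add, act_add, hb, hb', act_apply_add]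
    | single q s => simp [act_single, smul_smul]

lemma act_mem (a : E.FreeRing R) {n : E.ListModule R} (hn : n ∈ normalSubmodule c R ⊤) :
    act c a n ∈ normalSubmodule c R ⊤ := by
  induction a using MonoidAlgebra.induction_linear with
  | zero => rw [act_zero]; exact zero_mem _
  | add a b ha hb => rw [act_add]; exact add_mem ha hb
  | single p r => rw [act_single]; exact Submodule.smul_mem _ _ (wordEnd_mem p hn)

lemma act_vertexElt (x : V) (n : E.ListModule R) :
    act c (E.vertexElt R x) n = letterEnd c R (.vertex x) n := act_word _ _

lemma act_edgeElt (α : S) (i : ℕ) (n : E.ListModule R) :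
    act c (E.edgeElt R α i) n = edgeEnd c R α i n := by
  unfold edgeElt edgeEnd
  split_ifs
  · exact act_word _ _
  · simp [act_zero]

lemma act_ghostElt (α : S) (i : ℕ) (n : E.ListModule R) :
    act c (E.ghostElt R α i) n = ghostEnd c R α i n := by
  unfold ghostElt ghostEnd
  split_ifs
  · exact act_word _ _
  · simp [act_zero]

variable (E R) in
/-- The combinations of lists with source `s`. -/
def srcSubmodule (s : V) : Submodule R (E.ListModule R) :=
  Finsupp.supported R R {p | listSrc p.1 p.2 = s}

lemma listElt_mem_srcSubmodule {l : List E.Letter} {x s : V} (h : listSrc l x = s) :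
    listElt R l x ∈ srcSubmodule E R s := Finsupp.single_mem_supported R 1 h

lemma letterEnd_vertex_of_mem {s : V} {n : E.ListModule R} (hn : n ∈ srcSubmodule E R s) :
    letterEnd c R (.vertex s) n = n := by
  rw [srcSubmodule, Finsupp.supported_eq_span_single] at hn
  refine Submodule.span_induction (p := fun n _ => letterEnd c R (.vertex s) n = n) ?_ (map_zero _)
    (fun m n _ _ hm hn => by rw [map_add, hm, hn]) (fun r n _ hn => by rw [map_smul, hn]) hn
  rintro _ ⟨⟨l, x⟩, hp, rfl⟩
  change letterEnd c R (.vertex s) (listElt R l x) = listElt R l x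
  rw [letterEnd_listElt, letterMul]
  exact if_pos hp

lemma letterMul_mem_srcSubmodule (y : E.Letter) {l : List E.Letter} {x : V}
    (hl : NormalList c l x) : letterMul c R y l x ∈ srcSubmodule E R y.src := by
  by_cases hy : y.IsVertex
  · obtain ⟨z, rfl⟩ := hy
    rw [letterMul]
    split_ifs with h
    · exact listElt_mem_srcSubmodule h
    · exact zero_mem _
  by_cases h : y.tgt = listSrc l x
  · rw [letterMul_of_not_isVertex hy h]
    refine add_mem ?_ (topPart_mem_of_prefix (t := y.tgt) [] hy h hl ⟨hy, rfl, by simp, trivial⟩ _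
      fun l' _ h _ => listElt_mem_srcSubmodule h)
    unfold lowPart
    split
    · split_ifs with h1
      · exact listElt_mem_srcSubmodule (hl.2.1.symm.trans (congrArg E.src h1.1.1.symm))
      · exact zero_mem _
    · split_ifs with h1
      · exact listElt_mem_srcSubmodule (hl.2.1.symm.trans (congrArg E.tgt h1.2.symm))
      · exact zero_mem _
    · exact zero_mem _
  · rw [letterMul_of_ne (Ne.symm h)]; exact zero_mem _

lemma letterEnd_vertex_letterEnd (y : E.Letter) {k : ℕ∞} {n : E.ListModule R}
    (hn : n ∈ normalSubmodule c R k) :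
    letterEnd c R (.vertex y.src) (letterEnd c R y n) = letterEnd c R y n :=
  letterEnd_vertex_of_mem (map_mem_of_normalSubmodule _ _ k (fun l x hl _ => by
    rw [letterEnd_listElt]; exact letterMul_mem_srcSubmodule y hl) hn)

lemma letterEnd_letterEnd_vertex (y : E.Letter) (n : E.ListModule R) :
    letterEnd c R y (letterEnd c R (.vertex y.tgt) n) = letterEnd c R y n := by
  suffices (letterEnd c R y).comp (letterEnd c R (.vertex y.tgt)) = letterEnd c R y from
    DFunLike.congr_fun this n
  ext1 ⟨l, x⟩
  ext1
  change letterEnd c R y (letterEnd c R (.vertex y.tgt) (listElt R l x)) =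
    letterEnd c R y (listElt R l x)
  rw [letterEnd_listElt, letterEnd_listElt, letterMul]
  split_ifs with h
  · rw [letterEnd_listElt]
  · rw [letterMul_of_ne h, map_zero]

/-- Relations 1 and 2 are bookkeeping of sources and ranges; relations 3 and 4 are the two resolved
overlaps, extended from basis lists by linearity. -/
lemma act_eq_of_rel {a b : E.FreeRing R} (h : E.Rel R a b) {n : E.ListModule R}
    (hn : n ∈ normalSubmodule c R ⊤) : act c a n = act c b n := by
  cases h with
  | vertex_mul x y =>
    rw [act_mul, act_vertexElt, act_vertexElt]
    by_cases h : x = y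
    · subst h
      rw [if_pos rfl, act_vertexElt]
      exact letterEnd_vertex_letterEnd (.vertex x) hn
    · rw [if_neg h, act_zero]
      refine eqOn_normalSubmodule (f := (letterEnd c R (.vertex x)).comp
        (letterEnd c R (.vertex y))) (g := 0) (fun l z _ => ?_) hn
      rw [LinearMap.comp_apply, letterEnd_listElt, letterMul]
      split_ifs with h1
      · rw [letterEnd_listElt, letterMul, if_neg (fun h2 => h (h2.symm.trans h1))]; rfl
      · simp
  | src_mul_edge α i hi =>
    rw [act_mul, act_vertexElt, act_edgeElt, edgeEnd, dif_pos hi]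
    exact letterEnd_vertex_letterEnd (.edge α ⟨i, hi⟩) hn
  | edge_mul_tgt α i hi =>
    rw [act_mul, act_vertexElt, act_edgeElt, act_edgeElt, edgeEnd, dif_pos hi]
    exact letterEnd_letterEnd_vertex (.edge α ⟨i, hi⟩) n
  | tgt_mul_ghost α i hi =>
    rw [act_mul, act_vertexElt, act_ghostElt, ghostEnd, dif_pos hi]
    exact letterEnd_vertex_letterEnd (.ghost α ⟨i, hi⟩) hn
  | ghost_mul_src α i hi =>
    rw [act_mul, act_vertexElt, act_ghostElt, act_ghostElt, ghostEnd, dif_pos hi]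
    exact letterEnd_letterEnd_vertex (.ghost α ⟨i, hi⟩) n
  | sum_edge_mul_ghost x i j hi hj =>
    rw [act_sum]
    simp only [act_mul, act_edgeElt, act_ghostElt]
    have := eqOn_normalSubmodule (c := c) (k := ⊤)
      (f := ∑ α ∈ E.outEdges x, (edgeEnd c R α i).comp (ghostEnd c R α j))
      (g := if i = j then letterEnd c R (.vertex x) else 0)
      (fun l y hl => by
        simpa [LinearMap.sum_apply, apply_ite (fun f : E.ListModule R →ₗ[R] E.ListModule R =>
          f (listElt R l y))] using sum_edgeEnd_ghostEnd x hi hj hl) hn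
    simp only [LinearMap.sum_apply, LinearMap.comp_apply] at this
    rw [this]
    split_ifs
    · rw [act_vertexElt]
    · simp [act_zero]
  | sum_ghost_mul_edge α β =>
    rw [act_sum]
    simp only [act_mul, act_edgeElt, act_ghostElt]
    have := eqOn_normalSubmodule (c := c) (k := ⊤)
      (f := ∑ i ∈ Finset.range (max (E.weight α) (E.weight β)),
        (ghostEnd c R α i).comp (edgeEnd c R β i))
      (g := if α = β then letterEnd c R (.vertex (E.tgt α)) else 0)
      (fun l y hl => by
        simpa [LinearMap.sum_apply, apply_ite (fun f : E.ListModule R →ₗ[R] E.ListModule R =>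
          f (listElt R l y))] using sum_ghostEnd_edgeEnd α β (le_max_left _ _) hl) hn
    simp only [LinearMap.sum_apply, LinearMap.comp_apply] at this
    rw [this]
    split_ifs
    · rw [act_vertexElt]
    · simp [act_zero]

variable (c R) in
/-- The annihilator of the combinations of normal paths. -/
def actAnnihilator : TwoSidedIdeal (E.FreeRing R) :=
  TwoSidedIdeal.mk' {a | ∀ n ∈ normalSubmodule c R ⊤, act c a n = 0}
    (fun n _ => act_zero n)
    (fun ha hb n hn => by rw [act_add, ha n hn, hb n hn, add_zero])
    (fun ha n hn => by rw [← zero_sub, act_sub, ha n hn, act_zero, sub_zero])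
    (fun {a b} hb n hn => by
      rw [act_mul, hb n hn]
      -- The scalar `0` shows that `act c a` kills the zero vector.
      simpa using act_apply_smul (c := c) a 0 n |>.trans (by simp [act_zero]))
    (fun {a b} ha n hn => by rw [act_mul, ha _ (act_mem b hn)])

lemma relIdeal_le_actAnnihilator (c : E.SpecialEdges) : E.relIdeal R ≤ actAnnihilator c R := by
  refine sInf_le ⟨fun r a ha => ?_, fun a b hab => ?_⟩
  · simp only [actAnnihilator, TwoSidedIdeal.mem_mk', Set.mem_ofPred_eq] at ha ⊢
    refine ⟨fun n hn => ?_, fun n hn => ?_⟩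
    · rw [act_smul, ha n hn, smul_zero]
    · rw [← act_apply_smul, ha _ (Submodule.smul_mem _ _ hn)]
  · simp only [actAnnihilator, TwoSidedIdeal.mem_mk', Set.mem_ofPred_eq]
    intro n hn
    rw [act_sub, act_eq_of_rel hab hn, sub_self]

/-! ### Lists as words: how a normal word acts -/

/-- The word given by a list of letters with prescribed range. -/
def toWord : List E.Letter → V → E.Word
  | [], x => FreeSemigroup.of (.vertex x)
  | y :: l, _ => ⟨y, l⟩

variable (c R) in
/-- Iterated left multiplication. -/
def listEnd (l : List E.Letter) : Module.End R (E.ListModule R) :=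
  (l.map (letterEnd c R)).prod

lemma listEnd_cons (y : E.Letter) (l : List E.Letter) (n : E.ListModule R) :
    listEnd c R (y :: l) n = letterEnd c R y (listEnd c R l n) := by simp [listEnd]

lemma listEnd_append (l l' : List E.Letter) (n : E.ListModule R) :
    listEnd c R (l ++ l') n = listEnd c R l (listEnd c R l' n) := by simp [listEnd]

lemma listEnd_mem (l : List E.Letter) {k : ℕ∞} {n : E.ListModule R}
    (hn : n ∈ normalSubmodule c R k) : listEnd c R l n ∈ normalSubmodule c R (k + l.length) := by
  induction l with
  | nil => simpa [listEnd] using hn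
  | cons y l ih =>
    rw [listEnd_cons, List.length_cons, Nat.cast_add, ← add_assoc]
    exact letterEnd_mem y ih

lemma listEnd_listElt {l l' : List E.Letter} {x : V} (h : NormalList c (l ++ l') x) :
    listEnd c R l (listElt R l' x) = listElt R (l ++ l') x := by
  induction l with
  | nil => simp [listEnd]
  | cons y l ih =>
    rw [listEnd_cons, ih h.2.2.2, letterEnd_listElt]
    exact letterMul_of_not_isBad h.1 h.2.1 h.2.2.1

/-- The case distinction is forced by the empty list, which becomes a vertex and so acts as a
projection; for a nonempty list the last letter already kills a list with the wrong source. -/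
lemma wordEnd_toWord {l l' : List E.Letter} {x x' : V} (h : NormalList c l x) :
    wordEnd c R (toWord l x) (listElt R l' x') =
      if listSrc l' x' = x then listEnd c R l (listElt R l' x') else 0 := by
  induction l with
  | nil =>
    change letterEnd c R (.vertex x) (listElt R l' x') = _
    rw [letterEnd_listElt, letterMul]
    simp [listEnd]
  | cons y l ih =>
    cases l with
    | nil =>
      change letterEnd c R y (listElt R l' x') = _
      split_ifs with h1
      · simp [listEnd]
      · rw [letterEnd_listElt, letterMul_of_ne]
        rwa [show y.tgt = x from h.2.1]
    | cons z l =>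
      have : toWord (y :: z :: l) x = FreeSemigroup.of y * toWord (z :: l) x := rfl
      rw [this, map_mul, listEnd_cons, Module.End.mul_apply, ih h.2.2.2]
      change letterEnd c R y _ = _
      rw [apply_ite (letterEnd c R y), map_zero]

variable (R) in
/-- The inclusion of the combinations of lists into the free ring. -/
def toFree (n : E.ListModule R) : E.FreeRing R :=
  MonoidAlgebra.ofCoeff (Finsupp.mapDomain (fun p => toWord p.1 p.2) n)

lemma toFree_listElt (l : List E.Letter) (x : V) :
    toFree R (listElt R l x) = E.word R (toWord l x) := by
  simp [toFree, listElt, word, Finsupp.mapDomain_single]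

lemma toFree_add (m n : E.ListModule R) : toFree R (m + n) = toFree R m + toFree R n := by
  simp [toFree, Finsupp.mapDomain_add]

lemma toFree_smul (r : R) (n : E.ListModule R) : toFree R (r • n) = r • toFree R n := by
  simp [toFree, Finsupp.mapDomain_smul]

lemma toFree_zero : toFree R (0 : E.ListModule R) = 0 := by simp [toFree]

/-! ### Existence of normal representatives -/

lemma sub_mem_relIdeal {a b : E.FreeRing R} (h : E.Rel R a b) : a - b ∈ E.relIdeal R :=
  (TwoSidedIdeal.mem_sInf _).2 fun _ hJ => hJ.2 a b h

lemma smul_mem_relIdeal (r : R) {a : E.FreeRing R} (h : a ∈ E.relIdeal R) :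
    r • a ∈ E.relIdeal R :=
  (TwoSidedIdeal.mem_sInf _).2 fun _ hJ => (hJ.1 r a ((TwoSidedIdeal.mem_sInf _).1 h _ hJ)).1

lemma toLPA_eq_iff {a b : E.FreeRing R} : E.toLPA R a = E.toLPA R b ↔ a - b ∈ E.relIdeal R :=
  (RingCon.eq _).trans (TwoSidedIdeal.rel_iff _ _ _)

variable (E R) in
/-- The quotient map as a homomorphism. -/
def toLPAHom : E.FreeRing R →ₙ+* E.LPA R where
  toFun := E.toLPA R
  map_mul' _ _ := rfl
  map_zero' := rfl
  map_add' _ _ := rfl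

lemma toLPAHom_eq_of_rel {a b : E.FreeRing R} (h : E.Rel R a b) :
    toLPAHom E R a = toLPAHom E R b := toLPA_eq_iff.2 (sub_mem_relIdeal h)

lemma toLPAHom_smul_congr (r : R) {a b : E.FreeRing R} (h : toLPAHom E R a = toLPAHom E R b) :
    toLPAHom E R (r • a) = toLPAHom E R (r • b) := by
  refine toLPA_eq_iff.2 ?_
  rw [← smul_sub]
  exact smul_mem_relIdeal r (toLPA_eq_iff.1 h)

variable (R) in
/-- A letter as an element of the weighted Leavitt path algebra. -/
def letterLPA (y : E.Letter) : E.LPA R := toLPAHom E R (E.word R (FreeSemigroup.of y))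

variable (R) in
/-- The element of the weighted Leavitt path algebra given by a combination of lists. -/
def listLPA (n : E.ListModule R) : E.LPA R := toLPAHom E R (toFree R n)

lemma listLPA_add (m n : E.ListModule R) : listLPA R (m + n) = listLPA R m + listLPA R n := by
  rw [listLPA, toFree_add, map_add]; rfl

lemma listLPA_zero : listLPA R (0 : E.ListModule R) = 0 := by
  rw [listLPA, toFree_zero, map_zero]

lemma listLPA_neg (n : E.ListModule R) : listLPA R (-n) = -listLPA R n := by
  rw [eq_neg_iff_add_eq_zero, ← listLPA_add, neg_add_cancel, listLPA_zero]

lemma listLPA_sum {ι : Type*} (s : Finset ι) (n : ι → E.ListModule R) :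
    listLPA R (∑ i ∈ s, n i) = ∑ i ∈ s, listLPA R (n i) := by
  induction s using Finset.induction_on with
  | empty => simp [listLPA_zero]
  | insert i s hi ih => rw [Finset.sum_insert hi, Finset.sum_insert hi, listLPA_add, ih]

lemma word_mul (p q : E.Word) : E.word R p * E.word R q = E.word R (p * q) := by
  simp [word]

lemma letterLPA_vertex_mul_letterLPA (y : E.Letter) :
    letterLPA R (.vertex y.src) * letterLPA R y = letterLPA R y := by
  cases y with
  | vertex x =>
    have := toLPAHom_eq_of_rel (Rel.vertex_mul (R := R) (E := E) x x)
    rw [map_mul, if_pos rfl] at this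
    exact this
  | edge α i =>
    have := toLPAHom_eq_of_rel (Rel.src_mul_edge (R := R) α i.1 i.2)
    rw [map_mul, edgeElt, dif_pos i.2] at this
    exact this
  | ghost α i =>
    have := toLPAHom_eq_of_rel (Rel.tgt_mul_ghost (R := R) α i.1 i.2)
    rw [map_mul, ghostElt, dif_pos i.2] at this
    exact this

lemma letterLPA_mul_letterLPA_vertex (y : E.Letter) :
    letterLPA R y * letterLPA R (.vertex y.tgt) = letterLPA R y := by
  cases y with
  | vertex x =>
    have := toLPAHom_eq_of_rel (Rel.vertex_mul (R := R) (E := E) x x)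
    rw [map_mul, if_pos rfl] at this
    exact this
  | edge α i =>
    have := toLPAHom_eq_of_rel (Rel.edge_mul_tgt (R := R) α i.1 i.2)
    rw [map_mul, edgeElt, dif_pos i.2] at this
    exact this
  | ghost α i =>
    have := toLPAHom_eq_of_rel (Rel.ghost_mul_src (R := R) α i.1 i.2)
    rw [map_mul, ghostElt, dif_pos i.2] at this
    exact this

lemma listLPA_nil (x : V) : listLPA R (listElt R [] x) = letterLPA (E := E) R (.vertex x) := by
  rw [listLPA, toFree_listElt]; rfl

lemma listLPA_cons {y : E.Letter} {l : List E.Letter} {x : V} (h : y.tgt = listSrc l x) :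
    listLPA R (listElt R (y :: l) x) = letterLPA R y * listLPA R (listElt R l x) := by
  cases l with
  | nil =>
    rw [listLPA_nil, ← show y.tgt = x from h, letterLPA_mul_letterLPA_vertex, listLPA,
      toFree_listElt]
    rfl
  | cons z l =>
    rw [listLPA, listLPA, toFree_listElt, toFree_listElt, letterLPA, ← map_mul, word_mul]
    rfl

lemma letterLPA_vertex_mul_listLPA {l : List E.Letter} {x : V} (h : NormalList c l x) :
    letterLPA R (.vertex (listSrc l x)) * listLPA R (listElt R l x) =
      listLPA R (listElt R l x) := by
  cases l with
  | nil => rw [listLPA_nil]; exact letterLPA_vertex_mul_letterLPA (.vertex x)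
  | cons y l =>
    rw [listLPA_cons h.2.1, ← mul_assoc]
    exact congrArg (· * _) (letterLPA_vertex_mul_letterLPA y)

lemma letterLPA_mul_listLPA_of_ne {y : E.Letter} {l : List E.Letter} {x : V}
    (hl : NormalList c l x) (h : listSrc l x ≠ y.tgt) :
    letterLPA R y * listLPA R (listElt R l x) = 0 := by
  rw [← letterLPA_mul_letterLPA_vertex, ← letterLPA_vertex_mul_listLPA hl, ← mul_assoc,
    mul_assoc (letterLPA R y)]
  have : letterLPA R (.vertex y.tgt) * letterLPA (E := E) R (.vertex (listSrc l x)) = 0 := by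
    simpa [Ne.symm h] using! toLPAHom_eq_of_rel (Rel.vertex_mul (R := R) y.tgt (listSrc l x))
  rw [this]; simp

lemma listLPA_consEdge (α : S) (i : ℕ) {l : List E.Letter} {x : V} (h : E.tgt α = listSrc l x) :
    listLPA R (consEdge R α i (listElt R l x)) =
      toLPAHom E R (E.edgeElt R α i) * listLPA R (listElt R l x) := by
  by_cases hi : i < E.weight α
  · rw [consEdge_of_lt hi, edgeElt, dif_pos hi]; exact listLPA_cons h
  · rw [consEdge_of_le (not_lt.1 hi), edgeElt, dif_neg hi]; simp [listLPA_zero]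

lemma listLPA_consGhost (α : S) (i : ℕ) {l : List E.Letter} {x : V} (h : E.src α = listSrc l x) :
    listLPA R (consGhost R α i (listElt R l x)) =
      toLPAHom E R (E.ghostElt R α i) * listLPA R (listElt R l x) := by
  by_cases hi : i < E.weight α
  · rw [consGhost_of_lt hi, ghostElt, dif_pos hi]; exact listLPA_cons h
  · rw [consGhost_of_le (not_lt.1 hi), ghostElt, dif_neg hi]; simp [listLPA_zero]

lemma listLPA_consEdge_consGhost (α : S) (i j : ℕ) {l : List E.Letter} {x : V}
    (h : E.src α = listSrc l x) :
    listLPA R (consEdge R α i (consGhost R α j (listElt R l x))) =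
      toLPAHom E R (E.edgeElt R α i * E.ghostElt R α j) * listLPA R (listElt R l x) := by
  by_cases hj : j < E.weight α
  · rw [consGhost_of_lt hj, listLPA_consEdge α i rfl, ← consGhost_of_lt hj, listLPA_consGhost α j h,
      map_mul, mul_assoc]
  · rw [consGhost_of_le (not_lt.1 hj), ghostElt, dif_neg hj]; simp [listLPA_zero]

lemma listLPA_consGhost_consEdge {α β : S} (hs : E.src α = E.src β) (i j : ℕ) {l : List E.Letter}
    {x : V} (h : E.tgt β = listSrc l x) :
    listLPA R (consGhost R α i (consEdge R β j (listElt R l x))) =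
      toLPAHom E R (E.ghostElt R α i * E.edgeElt R β j) * listLPA R (listElt R l x) := by
  by_cases hj : j < E.weight β
  · rw [consEdge_of_lt hj, listLPA_consGhost α i hs, ← consEdge_of_lt hj, listLPA_consEdge β j h,
      map_mul, mul_assoc]
  · rw [consEdge_of_le (not_lt.1 hj), edgeElt, dif_neg hj]; simp [listLPA_zero]

/-- At a bad junction, `letterMul` is relation 3 solved for the special summand, or relation 4
solved for the first one, multiplied on the right by the tail. -/
lemma letterLPA_mul_listLPA (c : E.SpecialEdges) (y : E.Letter) {l : List E.Letter} {x : V}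
    (hl : NormalList c l x) :
    letterLPA R y * listLPA R (listElt R l x) = listLPA R (letterMul c R y l x) := by
  by_cases h : listSrc l x = y.tgt
  swap
  · rw [letterLPA_mul_listLPA_of_ne hl h, letterMul_of_ne h, listLPA_zero]
  by_cases hy : y.IsVertex
  · obtain ⟨z, rfl⟩ := hy
    obtain rfl : listSrc l x = z := h
    rw [letterMul, if_pos rfl]
    exact letterLPA_vertex_mul_listLPA hl
  by_cases hb : ∀ z ∈ l.head?, ¬ y.IsBad c z
  · rw [letterMul_of_not_isBad hy h.symm hb, listLPA_cons h.symm]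
  rw [letterMul_of_not_isVertex hy h.symm]
  push Not at hb
  obtain ⟨z, hz, hb⟩ := hb
  obtain ⟨l, rfl⟩ : ∃ l', l = z :: l' := by
    cases l with
    | nil => simp at hz
    | cons z' l => simp at hz; exact ⟨l, by rw [hz]⟩
  have hvl := letterLPA_vertex_mul_listLPA (R := R) hl.2.2.2
  have hzl := hl.2.1
  rw [listLPA_cons hl.2.1, ← mul_assoc]
  match y, z, hb with
  | .edge α i, .ghost β j, hb =>
    obtain ⟨rfl, hα⟩ : α = β ∧ c.IsSpecial α := hb
    replace hzl : E.src α = listSrc l x := hzl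
    have hrel := toLPAHom_eq_of_rel (Rel.sum_edge_mul_ghost (R := R) (E.src α) i j
      (i.2.trans_eq hα.weight_eq) (j.2.trans_eq hα.weight_eq))
    rw [map_sum, ← Finset.add_sum_erase _ _ (mem_outEdges.2 rfl), ← eq_sub_iff_add_eq] at hrel
    have h1 : letterLPA R (.edge α i) * letterLPA R (.ghost α j) =
        toLPAHom E R (E.edgeElt R α i * E.ghostElt R α j) := by
      simp [edgeElt, ghostElt, letterLPA]
    rw [h1, hrel, topPart, if_pos (show α = α ∧ c.IsSpecial α from ⟨rfl, hα⟩), lowPart, listLPA_add, listLPA_neg, listLPA_sum, sub_mul,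
      sub_eq_add_neg, Finset.sum_mul]
    congr 1
    · by_cases hij : i.val = j.val
      · rw [if_pos hij, if_pos ⟨⟨rfl, hα⟩, hij⟩, hzl]
        exact hvl
      · rw [if_neg hij, if_neg fun h => hij h.2, listLPA_zero, map_zero, zero_mul]
    · congr 1
      refine Finset.sum_congr rfl fun γ hγ => ?_
      rw [Finset.mem_erase, mem_outEdges] at hγ
      rw [listLPA_consEdge_consGhost _ _ _ (hγ.2.trans hzl)]
  | .ghost α i, .edge β j, hb =>
    obtain ⟨hi, hj⟩ : i.val = 0 ∧ j.val = 0 := hb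
    obtain rfl : i = ⟨0, E.weight_pos α⟩ := Fin.ext hi
    obtain rfl : j = ⟨0, E.weight_pos β⟩ := Fin.ext hj
    have hs : E.src α = E.src β := h.symm
    replace hzl : E.tgt β = listSrc l x := hzl
    have hrel := toLPAHom_eq_of_rel (Rel.sum_ghost_mul_edge (R := R) (E := E) α β)
    -- The sum is cut at the weight of `α`, beyond which the ghost edges are read as zero, and the
    -- term with index `0` is isolated.
    rw [map_sum, ← Finset.sum_subset (Finset.range_mono (le_max_left _ _)), Finset.range_eq_Ico,
      Finset.sum_eq_sum_Ico_succ_bot (E.weight_pos α), ← eq_sub_iff_add_eq] at hrel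
    swap
    · intro k _ hk
      rw [ghostElt, dif_neg (by simpa using hk), zero_mul, map_zero]
    have h1 : letterLPA R (.ghost α ⟨0, E.weight_pos α⟩) * letterLPA R (.edge β ⟨0, E.weight_pos β⟩) =
        toLPAHom E R (E.ghostElt R α 0 * E.edgeElt R β 0) := by
      simp [edgeElt, ghostElt, letterLPA, E.weight_pos]
    rw [h1, hrel, topPart, if_pos (show (0 = 0 ∧ 0 = 0) from ⟨rfl, rfl⟩), lowPart, listLPA_add, listLPA_neg, listLPA_sum, sub_mul,
      sub_eq_add_neg, Finset.sum_mul]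
    congr 1
    · by_cases hij : α = β
      · rw [if_pos hij, if_pos ⟨⟨rfl, rfl⟩, hij⟩, hij, hzl]
        exact hvl
      · rw [if_neg hij, if_neg fun h => hij h.2, listLPA_zero, map_zero, zero_mul]
    · congr 1
      refine Finset.sum_congr rfl fun γ hγ => ?_
      rw [listLPA_consGhost_consEdge hs _ _ hzl]

lemma word_mul_smul (p : E.Word) (r : R) (a : E.FreeRing R) :
    E.word R p * (r • a) = r • (E.word R p * a) := by
  induction a using MonoidAlgebra.induction_linear with
  | zero => simp
  | add a b ha hb => rw [smul_add, mul_add, mul_add, smul_add, ha, hb]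
  | single q s => simp [word]

lemma letterLPA_mul_listLPA_of_mem (y : E.Letter) {k : ℕ∞} {n : E.ListModule R}
    (hn : n ∈ normalSubmodule c R k) :
    letterLPA R y * listLPA R n = listLPA R (letterEnd c R y n) := by
  rw [normalSubmodule, Finsupp.supported_eq_span_single] at hn
  refine Submodule.span_induction
    (p := fun n _ => letterLPA R y * listLPA R n = listLPA R (letterEnd c R y n))
    ?_ ?_ (fun m n _ _ hm hn => ?_) (fun r n _ hn => ?_) hn
  · rintro _ ⟨⟨l, x⟩, hp, rfl⟩
    have := letterLPA_mul_listLPA (R := R) c y hp.1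
    rwa [← letterEnd_listElt] at this
  · rw [map_zero, listLPA_zero, mul_zero]
  · rw [listLPA_add, mul_add, hm, hn, map_add, listLPA_add]
  · rw [letterLPA, listLPA, ← map_mul, toFree_smul, word_mul_smul, LinearMap.map_smul, listLPA,
      toFree_smul]
    refine toLPAHom_smul_congr r ?_
    rw [map_mul]; exact hn

/-- Products in the algebra can therefore be computed in the module of lists; the degree formula is
proved there. -/
lemma toLPAHom_mul_listLPA (a : E.FreeRing R) {n : E.ListModule R}
    (hn : n ∈ normalSubmodule c R ⊤) :
    toLPAHom E R a * listLPA R n = listLPA R (act c a n) := by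
  induction a using MonoidAlgebra.induction_linear with
  | zero => rw [act_zero, map_zero, zero_mul, listLPA_zero]
  | add a b ha hb => rw [act_add, map_add, add_mul, ha, hb, listLPA_add]
  | single p r =>
    have : toLPAHom E R (E.word R p) * listLPA R n = listLPA R (wordEnd c R p n) := by
      induction p using FreeSemigroup.recOnMul generalizing n with
      | ih1 y => exact letterLPA_mul_listLPA_of_mem y hn
      | ih2 y p h1 h2 =>
        rw [← word_mul, map_mul, mul_assoc, h2 hn, h1 (wordEnd_mem p hn), map_mul]
        rfl
    rw [show MonoidAlgebra.single p r = r • E.word R p by simp [word], act_smul, act_word, listLPA,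
      ← map_mul, smul_mul_assoc, listLPA, toFree_smul]
    refine toLPAHom_smul_congr r ?_
    rw [map_mul]; exact this

lemma exists_listLPA_eq (c : E.SpecialEdges) (a : E.LPA R) :
    ∃ n ∈ normalSubmodule c R ⊤, listLPA R n = a := by
  obtain ⟨a, rfl⟩ : ∃ f, toLPAHom E R f = a := Quotient.exists_rep a
  induction a using MonoidAlgebra.induction_linear with
  | zero => exact ⟨0, zero_mem _, by rw [listLPA_zero, map_zero]⟩
  | add a b ha hb =>
    obtain ⟨m, hm, hm'⟩ := ha
    obtain ⟨n, hn, hn'⟩ := hb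
    exact ⟨m + n, add_mem hm hn, by rw [listLPA_add, hm', hn', map_add]⟩
  | single p r =>
    suffices ∃ n ∈ normalSubmodule c R ⊤, listLPA R n = toLPAHom E R (E.word R p) by
      obtain ⟨n, hn, hn'⟩ := this
      refine ⟨r • n, Submodule.smul_mem _ _ hn, ?_⟩
      rw [show MonoidAlgebra.single p r = r • E.word R p by simp [word], listLPA, toFree_smul]
      exact toLPAHom_smul_congr r hn'
    induction p using FreeSemigroup.recOnMul with
    | ih1 y =>
      -- A single letter is its product with the trivial path at its range.
      have h : listElt R [] y.tgt ∈ normalSubmodule c R ⊤ :=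
        listElt_mem_normalSubmodule trivial le_top
      refine ⟨letterEnd c R y (listElt R [] y.tgt), letterEnd_mem y h, ?_⟩
      rw [← letterLPA_mul_listLPA_of_mem y h, listLPA_nil, letterLPA_mul_letterLPA_vertex]
      rfl
    | ih2 y p _ h =>
      obtain ⟨n, hn, h⟩ := h
      refine ⟨letterEnd c R y n, letterEnd_mem y hn, ?_⟩
      rw [← letterLPA_mul_listLPA_of_mem y hn, h, ← word_mul, map_mul]
      rfl

/-! ### Uniqueness: a normal element is recovered from its action -/

variable (c) in
/-- The action on a fixed combination of lists, as a linear map. -/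
def actToFree (n : E.ListModule R) : E.ListModule R →ₗ[R] E.ListModule R where
  toFun m := act c (toFree R m) n
  map_add' _ _ := by rw [toFree_add, act_add]
  map_smul' _ _ := by rw [toFree_smul, act_smul]; rfl

lemma actToFree_listElt {l l' : List E.Letter} {x x' : V} (h : NormalList c l x) :
    actToFree c (listElt R l' x') (listElt R l x) =
      if listSrc l' x' = x then listEnd c R l (listElt R l' x') else 0 := by
  rw [← wordEnd_toWord h, ← act_word, ← toFree_listElt]
  rfl

/-- Acting on the trivial path at `x`, a normal list with range `x` is rebuilt letter by letter
without rewriting, and a list with another range gives zero. -/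
lemma actToFree_nil {m : E.ListModule R} (hm : m ∈ normalSubmodule c R ⊤) (l : List E.Letter)
    (x : V) : actToFree c (listElt R [] x) m (l, x) = m (l, x) := by
  refine eqOn_normalSubmodule (f := (Finsupp.lapply (l, x)).comp (actToFree c (listElt R [] x)))
    (g := Finsupp.lapply (l, x)) (fun l' x' h => ?_) hm
  rw [LinearMap.comp_apply, actToFree_listElt h]
  split_ifs with h'
  · obtain rfl : x = x' := h'
    rw [listEnd_listElt (by simpa using h), List.append_nil]
  · rw [map_zero, listElt, Finsupp.lapply_apply, Finsupp.single_eq_of_ne]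
    rintro ⟨⟩
    exact h' rfl

lemma eq_zero_of_listLPA_eq_zero {m : E.ListModule R} (hm : m ∈ normalSubmodule c R ⊤)
    (h : listLPA R m = 0) : m = 0 := by
  ext ⟨l, x⟩
  have h1 : toFree R m ∈ E.relIdeal R := by
    have := toLPA_eq_iff.1 (h.trans (map_zero (toLPAHom E R)).symm)
    rwa [sub_zero] at this
  have h2 := relIdeal_le_actAnnihilator c h1
  simp only [actAnnihilator, TwoSidedIdeal.mem_mk', Set.mem_ofPred_eq] at h2
  have h3 : NormalList c [] x := trivial
  rw [← actToFree_nil hm, actToFree, LinearMap.coe_mk, AddHom.coe_mk,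
    h2 _ (listElt_mem_normalSubmodule h3 le_top)]

lemma listLPA_injOn (c : E.SpecialEdges) :
    Set.InjOn (listLPA R) (normalSubmodule c R ⊤ : Set (E.ListModule R)) := by
  intro m hm n hn h
  rw [← sub_eq_zero]
  refine eq_zero_of_listLPA_eq_zero (c := c) (sub_mem hm hn) ?_
  rw [sub_eq_add_neg, listLPA_add, listLPA_neg, h, add_neg_cancel]

/-! ### Comparison with normal words and normal forms -/

/-- All forbidden subwords have two letters, so normality of a word can be checked junction by
junction. -/
lemma Letter.isBad_iff {y z : E.Letter} :
    y.IsBad c z ↔ ∃ q : E.Word, (q.IsTypeI c ∨ q.IsTypeII) ∧ q.letters = [y, z] := by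
  constructor
  · intro h
    match y, z, h with
    | .edge α i, .ghost β j, h =>
      obtain ⟨rfl, x, rfl⟩ := h
      exact ⟨_, .inl ⟨x, i, j, rfl⟩, rfl⟩
    | .ghost α i, .edge β j, h =>
      obtain ⟨hi, hj⟩ : i.val = 0 ∧ j.val = 0 := h
      obtain rfl : i = ⟨0, E.weight_pos α⟩ := Fin.ext hi
      obtain rfl : j = ⟨0, E.weight_pos β⟩ := Fin.ext hj
      exact ⟨_, .inr ⟨α, β, rfl⟩, rfl⟩
  · rintro ⟨q, ⟨x, i, j, rfl⟩ | ⟨α, β, rfl⟩, h⟩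
    · obtain ⟨rfl, rfl⟩ : Letter.edge _ i = y ∧ Letter.ghost _ j = z := by
        simpa [Word.letters, FreeSemigroup.of] using h
      exact ⟨rfl, x, rfl⟩
    · obtain ⟨rfl, rfl⟩ : Letter.ghost α ⟨0, E.weight_pos α⟩ = y ∧
          Letter.edge β ⟨0, E.weight_pos β⟩ = z := by
        simpa [Word.letters, FreeSemigroup.of] using h
      exact ⟨rfl, rfl⟩

lemma exists_letters_eq {q : E.Word} (h : q.IsTypeI c ∨ q.IsTypeII) :
    ∃ y z : E.Letter, q.letters = [y, z] := by
  rcases h with ⟨x, i, j, rfl⟩ | ⟨α, β, rfl⟩ <;> exact ⟨_, _, rfl⟩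

lemma NormalList.not_isVertex {l : List E.Letter} {x : V} (h : NormalList c l x) :
    ∀ y ∈ l, ¬ y.IsVertex := by
  induction l with
  | nil => simp
  | cons y l ih => exact List.forall_mem_cons.2 ⟨h.1, ih h.2.2.2⟩

lemma NormalList.isChain {l : List E.Letter} {x : V} (h : NormalList c l x) :
    l.IsChain (fun y z => y.tgt = z.src ∧ ¬ y.IsBad c z) := by
  induction l with
  | nil => exact List.isChain_nil
  | cons y l ih =>
    cases l with
    | nil => exact List.isChain_singleton _
    | cons z l => exact List.isChain_cons_cons.2 ⟨⟨h.2.1, h.2.2.1 z rfl⟩, ih h.2.2.2⟩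

lemma NormalList.isTrivial_iff {l : List E.Letter} {x : V} (h : NormalList c l x) :
    (toWord l x).IsTrivial ↔ l = [] := by
  constructor
  · rintro ⟨y, hy⟩
    cases l with
    | nil => rfl
    | cons z l => exact (h.1 ⟨y, congrArg FreeSemigroup.head hy⟩).elim
  · rintro rfl
    exact ⟨x, rfl⟩

lemma NormalList.pathLength_toWord {l : List E.Letter} {x : V} (h : NormalList c l x) :
    (toWord l x).pathLength = l.length := by
  rw [Word.pathLength, h.isTrivial_iff]
  cases l with
  | nil => rw [if_pos rfl]; rfl
  | cons y l => rw [if_neg (by simp)]; rfl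

lemma NormalList.isNormal {l : List E.Letter} {x : V} (h : NormalList c l x) :
    (toWord l x).IsNormal c := by
  constructor
  · cases l with
    | nil => exact .inl ⟨x, rfl⟩
    | cons y l => exact .inr ⟨h.not_isVertex, h.isChain.imp fun _ _ h => h.1⟩
  · intro q hq hinf
    obtain ⟨y, z, hyz⟩ := exists_letters_eq hq
    have hbad : y.IsBad c z := Letter.isBad_iff.2 ⟨q, hq, hyz⟩
    rw [hyz] at hinf
    cases l with
    | nil => simpa [Word.letters, toWord, FreeSemigroup.of] using hinf.length_le
    | cons t l =>
      have := h.isChain.infix hinf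
      rw [List.isChain_cons_cons] at this
      exact this.1.2 hbad

lemma exists_normalList_of_isChain (y : E.Letter) (l : List E.Letter)
    (hv : ∀ z ∈ y :: l, ¬ z.IsVertex) (hc : (y :: l).IsChain (fun y z => y.tgt = z.src))
    (hb : ∀ z t : E.Letter, [z, t] <:+: y :: l → ¬ z.IsBad c t) :
    ∃ x, NormalList c (y :: l) x := by
  induction l generalizing y with
  | nil => exact ⟨y.tgt, hv y (by simp), rfl, by simp, trivial⟩
  | cons z l ih =>
    rw [List.isChain_cons_cons] at hc
    obtain ⟨x, hx⟩ := ih z (fun t ht => hv t (List.mem_cons_of_mem _ ht)) hc.2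
      (fun s t hst => hb s t (hst.trans (List.suffix_cons _ _).isInfix))
    refine ⟨x, hv y (by simp), hc.1, ?_, hx⟩
    rintro _ ⟨⟩
    exact hb y z (List.IsPrefix.isInfix ⟨l, rfl⟩)

lemma exists_normalList {p : E.Word} (h : p.IsNormal c) :
    ∃ l x, NormalList c l x ∧ toWord l x = p := by
  obtain ⟨⟨x, rfl⟩ | ⟨hv, hc⟩, hb⟩ := h
  · exact ⟨[], x, trivial, rfl⟩
  · obtain ⟨x, hx⟩ := exists_normalList_of_isChain (c := c) p.head p.tail hv hc
      (fun z t hzt hbad => by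
        obtain ⟨q, hq, hq'⟩ := Letter.isBad_iff.1 hbad
        exact hb q hq (hq' ▸ hzt))
    exact ⟨_, x, hx, rfl⟩

lemma NormalList.range_unique {y : E.Letter} {l : List E.Letter} {x x' : V}
    (h : NormalList c (y :: l) x) (h' : NormalList c (y :: l) x') : x = x' := by
  induction l generalizing y with
  | nil => exact h.2.1.symm.trans h'.2.1
  | cons z l ih => exact ih h.2.2.2 h'.2.2.2

/-- Normality is essential: `toWord` forgets the range of a nonempty list, but normality forces it
to be the range of the last letter. It also excludes vertex letters, which separates empty from
nonempty lists. -/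
lemma toWord_injOn (c : E.SpecialEdges) :
    Set.InjOn (fun p : List E.Letter × V => toWord p.1 p.2) {p | NormalList c p.1 p.2} := by
  rintro ⟨l, x⟩ h ⟨l', x'⟩ h' heq
  cases l with
  | nil =>
    have : l' = [] := (NormalList.isTrivial_iff h').1 ⟨x, heq.symm⟩
    subst this
    obtain rfl : x = x' := by simpa [toWord, FreeSemigroup.of] using heq
    rfl
  | cons y l =>
    cases l' with
    | nil => cases (NormalList.isTrivial_iff h).1 ⟨x', heq⟩
    | cons y' l' =>
      obtain ⟨rfl, rfl⟩ : y = y' ∧ l = l' := by simpa [toWord] using heq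
      obtain rfl := NormalList.range_unique h h'
      rfl

lemma mem_normalSubmodule_top {m : E.ListModule R} :
    m ∈ normalSubmodule c R ⊤ ↔ ∀ p ∈ m.support, NormalList c p.1 p.2 := by
  rw [normalSubmodule, Finsupp.mem_supported]
  simp [Set.subset_def]

lemma support_toFree {m : E.ListModule R} (hm : m ∈ normalSubmodule c R ⊤) :
    (toFree R m).coeff.support = m.support.image (fun p => toWord p.1 p.2) :=
  Finsupp.mapDomain_support_of_injOn _
    ((toWord_injOn c).mono fun p hp => mem_normalSubmodule_top.1 hm p hp)

lemma isNormalElt_iff {f : E.FreeRing R} :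
    IsNormalElt c f ↔ ∃ m ∈ normalSubmodule c R ⊤, toFree R m = f := by
  constructor
  · intro h
    have hf : f.coeff ∈ Finsupp.supported R R {p : E.Word | p.IsNormal c} := h
    rw [Finsupp.supported_eq_span_single] at hf
    suffices ∀ g ∈ Submodule.span R ((fun p : E.Word => Finsupp.single p (1 : R)) ''
        {p | p.IsNormal c}), ∃ m ∈ normalSubmodule c R ⊤, toFree R m = .ofCoeff g from this _ hf
    intro g hg
    induction hg using Submodule.span_induction with
    | mem g hg =>
      obtain ⟨p, hp, rfl⟩ := hg
      obtain ⟨l, x, hl, rfl⟩ := exists_normalList hp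
      exact ⟨listElt R l x, listElt_mem_normalSubmodule hl le_top, toFree_listElt l x⟩
    | zero => exact ⟨0, zero_mem _, toFree_zero⟩
    | add g g' _ _ h h' =>
      obtain ⟨m, hm, hm'⟩ := h
      obtain ⟨n, hn, hn'⟩ := h'
      exact ⟨m + n, add_mem hm hn, by rw [toFree_add, hm', hn']; rfl⟩
    | smul r g _ h =>
      obtain ⟨m, hm, hm'⟩ := h
      exact ⟨r • m, Submodule.smul_mem _ _ hm, by rw [toFree_smul, hm']; rfl⟩
  · rintro ⟨m, hm, rfl⟩ p hp
    rw [support_toFree hm, Finset.mem_image] at hp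
    obtain ⟨q, hq, rfl⟩ := hp
    exact (mem_normalSubmodule_top.1 hm q hq).isNormal

lemma existsUnique_isNormalRep (c : E.SpecialEdges) (a : E.LPA R) :
    ∃! f : E.FreeRing R, IsNormalRep c a f := by
  obtain ⟨m, hm, rfl⟩ := exists_listLPA_eq c a
  refine ⟨toFree R m, ⟨isNormalElt_iff.2 ⟨m, hm, rfl⟩, rfl⟩, ?_⟩
  rintro f ⟨hf, hfm⟩
  obtain ⟨n, hn, rfl⟩ := isNormalElt_iff.1 hf
  rw [listLPA_injOn c hn hm hfm]

lemma NF_listLPA {m : E.ListModule R} (hm : m ∈ normalSubmodule c R ⊤) :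
    NF c (listLPA R m) = toFree R m := by
  have h := existsUnique_isNormalRep c (listLPA R m)
  rw [NF, dif_pos h.exists]
  exact h.unique h.exists.choose_spec ⟨isNormalElt_iff.2 ⟨m, hm, rfl⟩, rfl⟩

lemma supp_listLPA {m : E.ListModule R} (hm : m ∈ normalSubmodule c R ⊤) :
    supp c (listLPA R m) = m.support.image (fun p => toWord p.1 p.2) := by
  rw [supp, NF_listLPA hm, support_toFree hm]

/-! ### Top coefficients of products -/

/-- The maximal length of a list in the support. -/
def listDegree (m : E.ListModule R) : WithBot ℕ := m.support.sup fun p => (p.1.length : WithBot ℕ)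

lemma maxLength_listLPA {m : E.ListModule R} (hm : m ∈ normalSubmodule c R ⊤) :
    maxLength c (listLPA R m) = listDegree m := by
  rw [maxLength, supp_listLPA hm, Finset.sup_image]
  refine Finset.sup_congr rfl fun p hp => ?_
  rw [Function.comp_apply, (mem_normalSubmodule_top.1 hm p hp).pathLength_toWord]

/-- The junction `z₁ z₂` occurs in the part of maximal length of the product `y z`, where `y z` is
not normal. -/
def Letter.IsReduct : E.Letter → E.Letter → E.Letter → E.Letter → Prop
  | .edge α i, .ghost _ j, .edge γ k, .ghost δ l =>
      γ = δ ∧ γ ≠ α ∧ E.src γ = E.src α ∧ k.val = i.val ∧ l.val = j.val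
  | .ghost α _, .edge β _, .ghost γ k, .edge δ l =>
      γ = α ∧ δ = β ∧ k.val = l.val ∧ k.val ≠ 0
  | _, _, _, _ => False

variable (c R) in
/-- The coefficient of `z₁ z₂` in the part of maximal length of the product `y z`. -/
def pairCoeff (y z z₁ z₂ : E.Letter) : R :=
  if y.IsBad c z then (if y.IsReduct z z₁ z₂ then -1 else 0) else if y = z₁ ∧ z = z₂ then 1 else 0

lemma listElt_apply (l l' : List E.Letter) (x x' : V) :
    listElt R l x (l', x') = if l = l' ∧ x = x' then 1 else 0 := by
  simp only [listElt, Finsupp.single_apply, Prod.mk.injEq]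

lemma consEdge_consGhost_apply (γ : S) (i j : ℕ) (l l' : List E.Letter) (x x' : V)
    (z₁ z₂ : E.Letter) :
    consEdge R γ i (consGhost R γ j (listElt R l x)) (z₁ :: z₂ :: l', x') =
      if (∃ hi hj, .edge γ ⟨i, hi⟩ = z₁ ∧ .ghost γ ⟨j, hj⟩ = z₂) ∧ l = l' ∧ x = x'
        then 1 else 0 := by
  by_cases hj : j < E.weight γ
  · by_cases hi : i < E.weight γ
    · rw [consGhost_of_lt hj, consEdge_of_lt hi, listElt_apply]
      simp [hi, hj, and_assoc]
    · rw [consEdge_of_le (not_lt.1 hi), if_neg fun h => hi h.1.choose]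
      rfl
  · rw [consGhost_of_le (not_lt.1 hj), if_neg fun h => hj h.1.choose_spec.choose]
    simp

lemma consGhost_consEdge_apply (α β : S) (k : ℕ) (l l' : List E.Letter) (x x' : V)
    (z₁ z₂ : E.Letter) :
    consGhost R α k (consEdge R β k (listElt R l x)) (z₁ :: z₂ :: l', x') =
      if (∃ hi hj, .ghost α ⟨k, hi⟩ = z₁ ∧ .edge β ⟨k, hj⟩ = z₂) ∧ l = l' ∧ x = x'
        then 1 else 0 := by
  by_cases hj : k < E.weight β
  · by_cases hi : k < E.weight α
    · rw [consEdge_of_lt hj, consGhost_of_lt hi, listElt_apply]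
      simp [hi, hj, and_assoc]
    · rw [consGhost_of_le (not_lt.1 hi), if_neg fun h => hi h.1.choose]
      rfl
  · rw [consEdge_of_le (not_lt.1 hj), if_neg fun h => hj h.1.choose_spec.choose]
    simp

lemma sum_ite_exists_unique {ι : Type*} (s : Finset ι) (p : ι → Prop) [DecidablePred p]
    (h : ∀ i ∈ s, ∀ j ∈ s, p i → p j → i = j) :
    ∑ i ∈ s, (if p i then (1 : R) else 0) = if ∃ i ∈ s, p i then 1 else 0 := by
  split_ifs with hp
  · obtain ⟨i, hi, hpi⟩ := hp
    rw [Finset.sum_eq_single_of_mem i hi, if_pos hpi]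
    exact fun j hj hji => if_neg fun hpj => hji (h j hj i hi hpj hpi)
  · exact Finset.sum_eq_zero fun i hi => if_neg fun hpi => hp ⟨i, hi, hpi⟩

/-- The tail is untouched, and distinct nonzero terms of the correction sum are distinct words, so
coefficients never add up. -/
lemma topPart_apply (y z z₁ z₂ : E.Letter) (l l' : List E.Letter) (x x' : V) :
    topPart c R y (z :: l) x (z₁ :: z₂ :: l', x') =
      if l = l' ∧ x = x' then pairCoeff c R y z z₁ z₂ else 0 := by
  by_cases hb : y.IsBad c z
  swap
  · rw [topPart_of_not_isBad, listElt_apply, pairCoeff, if_neg hb]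
    · simp only [List.cons.injEq]
      split_ifs <;> first | rfl | (exfalso; tauto)
    · rintro _ ⟨⟩; exact hb
  rw [pairCoeff, if_pos hb]
  match y, z, hb with
  | .edge α i, .ghost β j, hb =>
    obtain ⟨rfl, hα⟩ : α = β ∧ c.IsSpecial α := hb
    rw [topPart, if_pos (show α = α ∧ c.IsSpecial α from ⟨rfl, hα⟩), Finsupp.neg_apply,
      Finsupp.finsetSum_apply]
    simp only [consEdge_consGhost_apply]
    rw [sum_ite_exists_unique]
    swap
    · rintro γ - δ - ⟨⟨_, _, h1, _⟩, _⟩ ⟨⟨_, _, h2, _⟩, _⟩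
      exact (Letter.edge.inj (h1.trans h2.symm)).1
    have : (∃ γ ∈ (E.outEdges (E.src α)).erase α,
        ((∃ hi hj, .edge γ ⟨i.val, hi⟩ = z₁ ∧ .ghost γ ⟨j.val, hj⟩ = z₂) ∧ l = l' ∧ x = x')) ↔
        (Letter.edge α i).IsReduct (.ghost α j) z₁ z₂ ∧ l = l' ∧ x = x' := by
      constructor
      · rintro ⟨γ, hγ, ⟨hi, hj, rfl, rfl⟩, h⟩
        rw [Finset.mem_erase, mem_outEdges] at hγ
        exact ⟨⟨rfl, hγ.1, hγ.2, rfl, rfl⟩, h⟩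
      · rintro ⟨h, h'⟩
        match z₁, z₂, h with
        | .edge γ ⟨k, hk⟩, .ghost δ ⟨m, hm⟩, h =>
          obtain ⟨rfl, h1, h2, h3, h4⟩ := h
          dsimp only at h3 h4
          subst h3 h4
          exact ⟨γ, Finset.mem_erase.2 ⟨h1, mem_outEdges.2 h2⟩, ⟨hk, hm, rfl, rfl⟩, h'⟩
    simp only [this]
    split_ifs <;> first | rfl | (exfalso; tauto) | simp
  | .ghost α i, .edge β j, hb =>
    replace hb : i.val = 0 ∧ j.val = 0 := hb
    rw [topPart, if_pos hb, Finsupp.neg_apply, Finsupp.finsetSum_apply]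
    simp only [consGhost_consEdge_apply]
    rw [sum_ite_exists_unique]
    swap
    · rintro k - m - ⟨⟨_, _, h1, _⟩, _⟩ ⟨⟨_, _, h2, _⟩, _⟩
      simpa using h1.trans h2.symm
    have : (∃ k ∈ Finset.Ico 1 (E.weight α),
        ((∃ hi hj, .ghost α ⟨k, hi⟩ = z₁ ∧ .edge β ⟨k, hj⟩ = z₂) ∧ l = l' ∧ x = x')) ↔
        (Letter.ghost α i).IsReduct (.edge β j) z₁ z₂ ∧ l = l' ∧ x = x' := by
      constructor
      · rintro ⟨k, hk, ⟨hi, hj, rfl, rfl⟩, h⟩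
        rw [Finset.mem_Ico] at hk
        exact ⟨⟨rfl, rfl, rfl, Nat.one_le_iff_ne_zero.1 hk.1⟩, h⟩
      · rintro ⟨h, h'⟩
        match z₁, z₂, h with
        | .ghost γ ⟨k, hk⟩, .edge δ ⟨m, hm⟩, h =>
          obtain ⟨rfl, rfl, h3, h4⟩ := h
          dsimp only at h3 h4
          subst h3
          exact ⟨k, Finset.mem_Ico.2 ⟨Nat.one_le_iff_ne_zero.2 h4, hk⟩, ⟨hk, hm, rfl, rfl⟩, h'⟩
    simp only [this]
    split_ifs <;> first | rfl | (exfalso; tauto) | simp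

lemma prefixMap_apply {l l' : List E.Letter} (h : l.length = l'.length) (l'' : List E.Letter)
    (x : V) (n : E.ListModule R) :
    prefixMap R l n (l' ++ l'', x) = if l = l' then n (l'', x) else 0 := by
  split_ifs with hl
  · subst hl
    refine Finsupp.mapDomain_apply ?_ n (l'', x)
    rintro ⟨a, b⟩ ⟨a', b'⟩ hab
    simpa using hab
  · refine Finsupp.mapDomain_of_notMem_range _ _ ?_
    rintro ⟨⟨a, b⟩, hab⟩
    exact hl (List.append_inj_left (Prod.mk.inj hab).1 h)

lemma apply_eq_zero_of_mem_normalSubmodule {n : E.ListModule R} {k : ℕ}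
    (hn : n ∈ normalSubmodule c R k) {l : List E.Letter} {x : V} (h : k < l.length) :
    n (l, x) = 0 := by
  refine (Finsupp.mem_supported' R n).1 hn _ fun h' => ?_
  have := h'.2
  rw [Nat.cast_le] at this
  exact absurd this (not_le.2 h)

lemma NormalList.of_append_right {l l' : List E.Letter} {x : V} (h : NormalList c (l ++ l') x) :
    NormalList c l' x := by
  induction l with
  | nil => exact h
  | cons y l ih => exact ih h.2.2.2

/-- In top length only the pair at the junction changes: the low part is too short to contribute,
and the top part can be prefixed by `P'` without rewriting. -/
lemma listEnd_append_singleton_apply {P P' : List E.Letter} {y z z₁ z₂ : E.Letter}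
    {l l' : List E.Letter} {x x' : V} (hP : P'.length = P.length) (hl : l.length = l'.length)
    (h₁ : NormalList c (P' ++ [y]) z.src) (h₂ : NormalList c (z :: l) x) :
    listEnd c R (P' ++ [y]) (listElt R (z :: l) x) (P ++ z₁ :: z₂ :: l', x') =
      if P' = P ∧ l = l' ∧ x = x' then pairCoeff c R y z z₁ z₂ else 0 := by
  have hy := h₁.of_append_right
  have hlow : listEnd c R P' (lowPart c R y (z :: l) x) ∈
      normalSubmodule c R ((z :: l).length + P'.length : ℕ) := by
    rw [Nat.cast_add]
    exact listEnd_mem P' (lowPart_mem y h₂)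
  have htop : topPart c R y (z :: l) x ∈ LinearMap.eqLocus (listEnd c R P') (prefixMap R P') :=
    topPart_mem_of_prefix P' hy.1 (show y.tgt = listSrc (z :: l) x from hy.2.1) h₂ h₁ _ fun l' _ _ hl' =>
      (listEnd_listElt hl').trans (prefixMap_listElt _ _ _).symm
  rw [LinearMap.mem_eqLocus] at htop
  rw [listEnd_append, listEnd_cons, show listEnd c R [] (listElt R (z :: l) x) =
    listElt R (z :: l) x from rfl, letterEnd_listElt, letterMul_of_not_isVertex hy.1 (show y.tgt = listSrc (z :: l) x from hy.2.1), map_add,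
    htop, Finsupp.add_apply, apply_eq_zero_of_mem_normalSubmodule hlow (by simp; omega), zero_add,
    prefixMap_apply hP, topPart_apply]
  split_ifs <;> first | rfl | (exfalso; tauto)

/-- `B` says that the normal pair `z₁ z₂` is produced by rewriting, and then `z₁' z₂'` is the only
bad pair producing it. If `B` fails, the primed letters play no role. -/
lemma listEnd_listElt_apply {P Q : List E.Letter} {z₁ z₂ z₁' z₂' : E.Letter} {B : Prop}
    (hz : ¬ z₁.IsBad c z₂) (hz' : B → z₁'.IsBad c z₂')
    (hred : ∀ y z : E.Letter, y.IsBad c z → (y.IsReduct z z₁ z₂ ↔ B ∧ y = z₁' ∧ z = z₂'))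
    {l l' : List E.Letter} {v x x' : V} (hl : NormalList c l v) (hl' : NormalList c l' x)
    (hv : listSrc l' x = v) (hP : l.length ≤ P.length + 1) (hQ : l'.length ≤ Q.length + 1) :
    listEnd c R l (listElt R l' x) (P ++ z₁ :: z₂ :: Q, x') =
      (if l = P ++ [z₁] ∧ (l', x) = (z₂ :: Q, x') then 1 else 0) -
        if B then (if l = P ++ [z₁'] ∧ (l', x) = (z₂' :: Q, x') then 1 else 0) else 0 := by
  -- If either factor is shorter than allowed, the product is too short to contain the word and both
  -- indicators vanish.
  by_cases hlen : l.length = P.length + 1 ∧ l'.length = Q.length + 1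
  swap
  · have h1 := listEnd_mem (R := R) l (listElt_mem_normalSubmodule (R := R) hl' le_rfl)
    rw [← Nat.cast_add] at h1
    have h2 : ∀ y z : E.Letter, ¬ (l = P ++ [y] ∧ (l', x) = (z :: Q, x')) := by
      rintro y z ⟨rfl, h⟩
      obtain ⟨rfl, -⟩ := Prod.mk.inj h
      simp at hlen
    rw [apply_eq_zero_of_mem_normalSubmodule h1 (by simp; omega), if_neg (h2 _ _),
      if_neg (h2 _ _), ite_self, sub_zero]
  obtain ⟨P', y, rfl⟩ : ∃ P' y, l = P' ++ [y] :=
    ⟨l.dropLast, l.getLast (by rintro rfl; simp at hlen), (List.dropLast_append_getLast _).symm⟩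
  obtain ⟨z, l', rfl⟩ : ∃ z l'', l' = z :: l'' := by
    cases l' with
    | nil => simp at hlen
    | cons z l' => exact ⟨z, l', rfl⟩
  subst hv
  rw [listEnd_append_singleton_apply (by simpa using hlen.1) (by simpa using hlen.2) hl hl']
  have e : ∀ y' z' : E.Letter, (P' ++ [y] = P ++ [y'] ∧ (z :: l', x) = (z' :: Q, x')) ↔
      (P' = P ∧ l' = Q ∧ x = x') ∧ y = y' ∧ z = z' := by
    intro y' z'
    rw [Prod.mk.injEq, List.cons.injEq]
    constructor
    · rintro ⟨h, ⟨h1, h2⟩, h3⟩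
      obtain ⟨h4, h5⟩ := List.append_inj h (by simpa using hlen.1)
      exact ⟨⟨h4, h2, h3⟩, (List.cons.inj h5).1, h1⟩
    · rintro ⟨⟨rfl, rfl, rfl⟩, rfl, rfl⟩
      exact ⟨rfl, ⟨rfl, rfl⟩, rfl⟩
  simp only [e]
  by_cases hc : P' = P ∧ l' = Q ∧ x = x'
  swap
  · simp [hc]
  rw [if_pos hc]
  simp only [hc, true_and, and_self]
  rw [pairCoeff]
  by_cases hb : y.IsBad c z
  · have h3 : ¬ (y = z₁ ∧ z = z₂) := by rintro ⟨rfl, rfl⟩; exact hz hb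
    rw [if_pos hb, if_neg h3, hred y z hb]
    split_ifs <;> first | (exfalso; tauto) | simp
  · rw [if_neg hb]
    by_cases hB : B
    · have h3 : ¬ (y = z₁' ∧ z = z₂') := by rintro ⟨rfl, rfl⟩; exact hb (hz' hB)
      rw [if_neg h3, ite_self, sub_zero]
    · rw [if_neg hB, sub_zero]

lemma single_eq_smul_listElt (l : List E.Letter × V) (r : R) :
    Finsupp.single l r = r • listElt (E := E) R l.1 l.2 := by simp [listElt]

lemma actToFree_eq_sum {m n : E.ListModule R} {v : V}
    (hm : ∀ p ∈ m.support, NormalList c p.1 p.2 ∧ p.2 = v)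
    (hn : ∀ q ∈ n.support, listSrc q.1 q.2 = v) :
    actToFree c n m = m.sum fun p r => r • n.sum fun q s => s • listEnd c R p.1 (listElt R q.1 q.2) := by
  conv_lhs => rw [← Finsupp.sum_single m, map_finsuppSum]
  refine Finsupp.sum_congr fun p hp => ?_
  rw [single_eq_smul_listElt, map_smul]
  congr 1
  have : actToFree c n (listElt R p.1 p.2) = wordEnd c R (toWord p.1 p.2) n := by
    rw [← act_word, ← toFree_listElt]; rfl
  rw [this]
  conv_lhs => rw [← Finsupp.sum_single n, map_finsuppSum]
  refine Finsupp.sum_congr fun q hq => ?_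
  rw [single_eq_smul_listElt, map_smul, wordEnd_toWord (hm p hp).1, if_pos ((hn q hq).trans (hm p hp).2.symm)]

lemma sum_mul_sum_ite {X : Type*} [DecidableEq X] (m n : X →₀ R) (p₀ q₀ : X) :
    (m.sum fun p r => r * n.sum fun q s => s * if p = p₀ ∧ q = q₀ then 1 else 0) = m p₀ * n q₀ := by
  have : ∀ p r, (r * n.sum fun q s => s * if p = p₀ ∧ q = q₀ then 1 else 0) =
      if p = p₀ then r * n q₀ else 0 := by
    intro p r
    by_cases h : p = p₀
    · simp +contextual [h, Finsupp.sum]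
    · simp [h]
  simp only [this]
  simp +contextual [Finsupp.sum]

/-- The bilinear extension of `listEnd_listElt_apply`. Coefficients of `m` stay on the left, as `R`
need not be commutative. -/
lemma actToFree_apply {m n : E.ListModule R} {v : V} {P Q : List E.Letter}
    (hm : ∀ p ∈ m.support, NormalList c p.1 p.2 ∧ p.2 = v ∧ p.1.length ≤ P.length + 1)
    (hn : ∀ q ∈ n.support, NormalList c q.1 q.2 ∧ listSrc q.1 q.2 = v ∧
      q.1.length ≤ Q.length + 1) {z₁ z₂ z₁' z₂' : E.Letter} {B : Prop}
    (hz : ¬ z₁.IsBad c z₂) (hz' : B → z₁'.IsBad c z₂')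
    (hred : ∀ y z : E.Letter, y.IsBad c z → (y.IsReduct z z₁ z₂ ↔ B ∧ y = z₁' ∧ z = z₂')) (x : V) :
    actToFree c n m (P ++ z₁ :: z₂ :: Q, x) = m (P ++ [z₁], v) * n (z₂ :: Q, x) -
      if B then m (P ++ [z₁'], v) * n (z₂' :: Q, x) else 0 := by
  rw [actToFree_eq_sum (fun p hp => ⟨(hm p hp).1, (hm p hp).2.1⟩) (fun q hq => (hn q hq).2.1)]
  have h : ∀ p ∈ m.support, ∀ q ∈ n.support,
      listEnd c R p.1 (listElt R q.1 q.2) (P ++ z₁ :: z₂ :: Q, x) =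
      (if p = (P ++ [z₁], v) ∧ q = (z₂ :: Q, x) then 1 else 0) -
        if B then (if p = (P ++ [z₁'], v) ∧ q = (z₂' :: Q, x) then 1 else 0) else 0 := by
    rintro ⟨l, v'⟩ hp ⟨l', x'⟩ hq
    obtain ⟨h1, rfl, h2⟩ := hm _ hp
    obtain ⟨h3, h4, h5⟩ := hn _ hq
    rw [listEnd_listElt_apply hz hz' hred h1 h3 h4 h2 h5]
    simp only [Prod.mk.injEq, and_true]
  rw [Finsupp.sum_apply]
  have h' : ∀ p ∈ m.support, ((m p) • n.sum fun q s => s • listEnd c R p.1 (listElt R q.1 q.2))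
      (P ++ z₁ :: z₂ :: Q, x) =
      (m p * n.sum fun q s => s * if p = (P ++ [z₁], v) ∧ q = (z₂ :: Q, x) then 1 else 0) -
      if B then (m p * n.sum fun q s => s * if p = (P ++ [z₁'], v) ∧ q = (z₂' :: Q, x) then 1 else 0)
        else 0 := by
    intro p hp
    rw [Finsupp.smul_apply, Finsupp.sum_apply, smul_eq_mul]
    have : (n.sum fun q s => (s • listEnd c R p.1 (listElt R q.1 q.2)) (P ++ z₁ :: z₂ :: Q, x)) =
        (n.sum fun q s => s * if p = (P ++ [z₁], v) ∧ q = (z₂ :: Q, x) then 1 else 0) -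
        if B then (n.sum fun q s => s * if p = (P ++ [z₁'], v) ∧ q = (z₂' :: Q, x) then 1 else 0)
        else 0 := by
      split_ifs with hB
      · rw [← Finsupp.sum_sub]
        refine Finsupp.sum_congr fun q hq => ?_
        rw [Finsupp.smul_apply, h p hp q hq, if_pos hB, smul_eq_mul, mul_sub]
      · rw [sub_zero]
        refine Finsupp.sum_congr fun q hq => ?_
        rw [Finsupp.smul_apply, h p hp q hq, if_neg hB, smul_eq_mul, sub_zero]
    rw [this, mul_sub, mul_ite, mul_zero]
  rw [Finsupp.sum, Finset.sum_congr rfl h', ← sum_mul_sum_ite m n (P ++ [z₁], v) (z₂ :: Q, x),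
    ← sum_mul_sum_ite m n (P ++ [z₁'], v) (z₂' :: Q, x)]
  split_ifs
  · rw [Finset.sum_sub_distrib]
    rfl
  · simp only [sub_zero]
    rfl

/-! ### The top part of a product does not vanish -/

lemma IsLV.exists_ne_weight_eq (hE : E.IsLV) {α : S} (hα : c.IsSpecial α) :
    ∃ γ, γ ≠ α ∧ E.src γ = E.src α ∧ E.weight γ = E.weight α := by
  have h := hE.two_le_card (E.src α) ⟨α, rfl⟩
  obtain ⟨γ, hγ, hne⟩ := Finset.exists_mem_ne (Nat.lt_of_succ_le h) α
  rw [Finset.mem_filter, mem_outEdges] at hγ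
  exact ⟨γ, hne, hγ.1, hγ.2.trans hα.weight_eq.symm⟩

/-- Two combinations of normal paths with nonzero parts of maximal length have a product with a
nonzero part of maximal length. -/
lemma exists_actToFree_apply_ne_zero [IsDomain R] (hE : E.IsLV) {m n : E.ListModule R} {v : V}
    {P Q : List E.Letter}
    (hm : ∀ p ∈ m.support, NormalList c p.1 p.2 ∧ p.2 = v ∧ p.1.length ≤ P.length + 1)
    (hn : ∀ q ∈ n.support, NormalList c q.1 q.2 ∧ listSrc q.1 q.2 = v ∧
      q.1.length ≤ Q.length + 1) {y z : E.Letter} {x : V} (hy : m (P ++ [y], v) ≠ 0)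
    (hz : n (z :: Q, x) ≠ 0) :
    ∃ z₁ z₂, actToFree c n m (P ++ z₁ :: z₂ :: Q, x) ≠ 0 := by
  by_contra! hzero
  -- A normal pair that no rule produces has the plain product as its coefficient, which cannot
  -- vanish in a domain.
  have hfree : ∀ z₁ z₂ : E.Letter, ¬ z₁.IsBad c z₂ →
      (∀ y z : E.Letter, y.IsBad c z → ¬ y.IsReduct z z₁ z₂) →
      m (P ++ [z₁], v) ≠ 0 → n (z₂ :: Q, x) ≠ 0 → False := by
    intro z₁ z₂ h1 h2 h3 h4
    have h := actToFree_apply (z₁' := z₁) (z₂' := z₂) (B := False) hm hn h1 (fun h => h.elim)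
      (fun y z hyz => ⟨fun h => (h2 y z hyz h).elim, fun h => h.1.elim⟩) x
    rw [hzero, if_neg not_false, sub_zero] at h
    exact mul_ne_zero h3 h4 h.symm
  -- For a pair produced by a rule, a vanishing coefficient equates its product with that of the bad
  -- pair.
  have hred : ∀ z₁ z₂ z₁' z₂' : E.Letter, ¬ z₁.IsBad c z₂ → z₁'.IsBad c z₂' →
      (∀ y z : E.Letter, y.IsBad c z → (y.IsReduct z z₁ z₂ ↔ y = z₁' ∧ z = z₂')) →
      m (P ++ [z₁], v) * n (z₂ :: Q, x) = m (P ++ [z₁'], v) * n (z₂' :: Q, x) := by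
    intro z₁ z₂ z₁' z₂' h1 h2 h3
    have h := actToFree_apply (B := True) hm hn h1 (fun _ => h2)
      (fun y z hyz => by rw [h3 y z hyz, true_and]) x
    rw [hzero, if_pos trivial] at h
    exact sub_eq_zero.1 h.symm
  have hfree_edge : ∀ (α β : S) i j, α ≠ β → m (P ++ [.edge α i], v) ≠ 0 →
      n (.ghost β j :: Q, x) ≠ 0 → False := fun α β i j hαβ =>
    hfree _ _ (fun h => hαβ h.1) fun y z _ h => by
      match y, z, h with
      | .edge _ _, .ghost _ _, h => exact hαβ h.1
  have hfree_ghost : ∀ (α β : S) i j, i.val ≠ j.val → m (P ++ [.ghost α i], v) ≠ 0 →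
      n (.edge β j :: Q, x) ≠ 0 → False := fun α β i j hij =>
    hfree _ _ (fun h => hij (h.1.trans h.2.symm)) fun y z _ h => by
      match y, z, h with
      | .ghost _ _, .edge _ _, h => exact hij h.2.2.1
  have hred_edge : ∀ (α γ : S), c.IsSpecial α → γ ≠ α → E.src γ = E.src α →
      ∀ i j (hi : i < E.weight γ) (hj : j < E.weight γ) (hi' : i < E.weight α)
        (hj' : j < E.weight α),
      m (P ++ [.edge γ ⟨i, hi⟩], v) * n (.ghost γ ⟨j, hj⟩ :: Q, x) =
        m (P ++ [.edge α ⟨i, hi'⟩], v) * n (.ghost α ⟨j, hj'⟩ :: Q, x) := by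
    intro α γ hα hγ hs i j hi hj hi' hj'
    refine hred _ _ _ _ (fun h => hγ (h.2.eq_of_src_eq hα hs)) ⟨rfl, hα⟩ fun y z hyz => ?_
    match y, z, hyz with
    | .edge α' ⟨i', hi''⟩, .ghost β' ⟨j', hj''⟩, hyz =>
      obtain ⟨rfl, hα'⟩ := hyz
      constructor
      · rintro ⟨-, h1, h2, h3, h4⟩
        obtain rfl := hα'.eq_of_src_eq hα (h2.symm.trans hs)
        dsimp only at h3 h4
        subst h3 h4
        exact ⟨rfl, rfl⟩
      · rintro ⟨h1, h2⟩
        cases h1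
        cases h2
        exact ⟨rfl, hγ, hs, rfl, rfl⟩
    | .ghost α' i', .edge β' j', hyz =>
      constructor
      · intro h; exact h.elim
      · rintro ⟨⟨⟩, _⟩
  have hred_ghost : ∀ (α β : S) (k : ℕ) (hi : k < E.weight α) (hj : k < E.weight β), k ≠ 0 →
      m (P ++ [.ghost α ⟨k, hi⟩], v) * n (.edge β ⟨k, hj⟩ :: Q, x) =
        m (P ++ [.ghost α ⟨0, E.weight_pos α⟩], v) *
          n (.edge β ⟨0, E.weight_pos β⟩ :: Q, x) := by
    intro α β k hi hj hk
    refine hred _ _ _ _ (fun h => hk h.1) ⟨rfl, rfl⟩ fun y z hyz => ?_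
    match y, z, hyz with
    | .ghost α' ⟨i', hi'⟩, .edge β' ⟨j', hj'⟩, hyz =>
      obtain ⟨h1, h2⟩ : i' = 0 ∧ j' = 0 := hyz
      subst h1 h2
      constructor
      · rintro ⟨rfl, rfl, -, -⟩
        exact ⟨rfl, rfl⟩
      · rintro ⟨h1, h2⟩
        cases h1
        cases h2
        exact ⟨rfl, rfl, rfl, hk⟩
    | .edge α' i', .ghost β' j', hyz =>
      constructor
      · intro h; exact h.elim
      · rintro ⟨⟨⟩, _⟩
  have hyv : ¬ y.IsVertex :=
    ((hm _ (Finsupp.mem_support_iff.2 hy)).1.of_append_right (l := P)).1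
  have hzv : ¬ z.IsVertex := (hn _ (Finsupp.mem_support_iff.2 hz)).1.1
  match y, z with
  | .vertex _, _ => exact hyv ⟨_, rfl⟩
  | _, .vertex _ => exact hzv ⟨_, rfl⟩
  | .edge α i, .edge β j =>
    exact hfree (.edge α i) (.edge β j) id (fun y z _ h => by cases y <;> cases z <;> exact h) hy hz
  | .ghost α i, .ghost β j =>
    exact hfree (.ghost α i) (.ghost β j) id (fun y z _ h => by cases y <;> cases z <;> exact h)
      hy hz
  | .edge γ ⟨i, hi⟩, .ghost δ ⟨j, hj⟩ =>
    by_cases hγδ : γ = δ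
    swap
    · exact hfree_edge γ δ _ _ hγδ hy hz
    subst hγδ
    -- For special `γ`, let `α` be another edge of maximal weight; otherwise let `α` be the special
    -- edge at the same source. In both cases equality of products gives `n (α_j^* Q) ≠ 0`, and `γ_i
    -- α_j^*` is a pair that no rule produces.
    by_cases hγ : c.IsSpecial γ
    · obtain ⟨α, hα, hs, hw⟩ := hE.exists_ne_weight_eq hγ
      have h := hred_edge γ α hγ hα hs i j (hw.symm ▸ hi) (hw.symm ▸ hj) hi hj
      have h' := h.trans_ne (mul_ne_zero hy hz)
      exact hfree_edge γ α _ _ hα.symm hy (right_ne_zero_of_mul h')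
    · obtain ⟨α, hα, hs⟩ := exists_isSpecial c γ
      have hγα : γ ≠ α := fun h => hγ (h ▸ hα)
      have hw : E.weight γ ≤ E.weight α := by
        rw [hα.weight_eq]; exact weight_le_vertexWeight hs.symm
      have h := hred_edge α γ hα hγα hs.symm i j hi hj (hi.trans_le hw) (hj.trans_le hw)
      have h' := h.symm.trans_ne (mul_ne_zero hy hz)
      exact hfree_edge γ α _ _ hγα hy (right_ne_zero_of_mul h')
  | .ghost α ⟨i, hi⟩, .edge β ⟨j, hj⟩ =>
    by_cases hij : i = j
    swap
    · exact hfree_ghost α β ⟨i, hi⟩ ⟨j, hj⟩ hij hy hz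
    subst hij
    by_cases hi0 : i = 0
    · subst hi0
      -- Index `1` is the second one; it exists because all weights are at least two. The
      -- contradiction comes from the mixed pair of indices `0` and `1`.
      have h := hred_ghost α β 1 (hE.two_le_weight α) (hE.two_le_weight β) one_ne_zero
      have h' := h.trans_ne (mul_ne_zero hy hz)
      exact hfree_ghost α β ⟨0, hi⟩ ⟨1, hE.two_le_weight β⟩ zero_ne_one hy (right_ne_zero_of_mul h')
    · have h := hred_ghost α β i hi hj hi0
      have h' := h.symm.trans_ne (mul_ne_zero hy hz)
      exact hfree_ghost α β ⟨i, hi⟩ ⟨0, E.weight_pos β⟩ hi0 hy (right_ne_zero_of_mul h')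

/-! ### Degrees of products -/

lemma listDegree_eq_coe {m : E.ListModule R} {k : ℕ} (hk : ∀ p ∈ m.support, p.1.length ≤ k)
    {p : List E.Letter × V} (hp : m p ≠ 0) (hpk : p.1.length = k) : listDegree m = k := by
  refine le_antisymm (Finset.sup_le fun q hq => by exact_mod_cast hk q hq) ?_
  rw [← hpk]
  exact Finset.le_sup (f := fun p : List E.Letter × V => (p.1.length : WithBot ℕ))
    (Finsupp.mem_support_iff.2 hp)

lemma exists_listDegree_eq {m : E.ListModule R} (hm : m ≠ 0) :
    ∃ p, m p ≠ 0 ∧ listDegree m = (p.1.length : WithBot ℕ) ∧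
      ∀ q ∈ m.support, q.1.length ≤ p.1.length := by
  obtain ⟨p, hp, h⟩ := m.support.exists_max_image (fun p => p.1.length)
    (Finsupp.support_nonempty_iff.2 hm)
  exact ⟨p, Finsupp.mem_support_iff.1 hp,
    listDegree_eq_coe h (Finsupp.mem_support_iff.1 hp) rfl, h⟩

lemma listDegree_eq_bot_iff {m : E.ListModule R} : listDegree m = ⊥ ↔ m = 0 := by
  constructor
  · intro h
    by_contra hm
    obtain ⟨p, -, hp, -⟩ := exists_listDegree_eq hm
    rw [h] at hp
    exact WithBot.bot_ne_coe hp
  · rintro rfl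
    simp [listDegree]

lemma listDegree_eq_zero_iff {m : E.ListModule R} :
    listDegree m = 0 ↔ m ≠ 0 ∧ ∀ p ∈ m.support, p.1 = [] := by
  constructor
  · intro h
    have hm : m ≠ 0 := by
      rintro rfl
      rw [listDegree_eq_bot_iff.2 rfl] at h
      exact WithBot.bot_ne_zero h
    obtain ⟨p, -, hp, hmax⟩ := exists_listDegree_eq hm
    rw [h] at hp
    have hp' : p.1.length = 0 := by exact_mod_cast hp.symm
    exact ⟨hm, fun q hq => List.length_eq_zero_iff.1 (Nat.le_zero.1 (hp' ▸ hmax q hq))⟩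
  · rintro ⟨hm, h⟩
    obtain ⟨p, hp, hp', -⟩ := exists_listDegree_eq hm
    rw [hp', h p (Finsupp.mem_support_iff.2 hp)]
    rfl

lemma listDegree_add_le (m n : E.ListModule R) :
    listDegree (m + n) ≤ max (listDegree m) (listDegree n) := by
  rw [listDegree, listDegree, listDegree, ← Finset.sup_union]
  exact Finset.sup_mono Finsupp.support_add

/-- Lengths at most add up, since each letter raises length by at most one. Equality comes from
`exists_actToFree_apply_ne_zero` when both degrees are positive; in degree zero there is no junction
to rewrite. -/
lemma listDegree_actToFree [IsDomain R] (hE : E.IsLV) {m n : E.ListModule R} {v : V}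
    (hm : ∀ p ∈ m.support, NormalList c p.1 p.2 ∧ p.2 = v)
    (hn : ∀ q ∈ n.support, NormalList c q.1 q.2 ∧ listSrc q.1 q.2 = v) :
    listDegree (actToFree c n m) = listDegree m + listDegree n := by
  have hsum := actToFree_eq_sum hm (fun q hq => (hn q hq).2)
  by_cases hm0 : m = 0
  · rw [hm0, map_zero, listDegree_eq_bot_iff.2 rfl, WithBot.bot_add]
  by_cases hn0 : n = 0
  · rw [hsum, hn0, (listDegree_eq_bot_iff (m := (0 : E.ListModule R))).2 rfl, WithBot.add_bot, listDegree_eq_bot_iff]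
    simp
  obtain ⟨⟨l, v'⟩, hp, hdm, hmaxm⟩ := exists_listDegree_eq hm0
  obtain ⟨⟨l', x⟩, hq, hdn, hmaxn⟩ := exists_listDegree_eq hn0
  obtain rfl : v' = v := (hm _ (Finsupp.mem_support_iff.2 hp)).2
  rw [hdm, hdn, ← Nat.cast_add]
  have hupper : actToFree c n m ∈ normalSubmodule c R (l.length + l'.length : ℕ) := by
    rw [hsum]
    refine sum_mem fun p hp => Submodule.smul_mem _ _ (sum_mem fun q hq => Submodule.smul_mem _ _ ?_)
    refine normalSubmodule_mono ?_ (listEnd_mem p.1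
      (listElt_mem_normalSubmodule (hn q hq).1 le_rfl))
    have h1 := hmaxm p hp
    have h2 := hmaxn q hq
    dsimp only at h1 h2
    norm_cast
    omega
  have hle : ∀ p ∈ (actToFree c n m).support, p.1.length ≤ l.length + l'.length :=
    fun p hp => Nat.cast_le.1 (hupper hp).2
  rcases List.eq_nil_or_concat l with rfl | ⟨P, y, rfl⟩
  -- All ranges agree, so a factor of degree zero is a scalar multiple of a single trivial path.
  · have hm' : m = Finsupp.single ([], v') (m ([], v')) := by
      refine (Finsupp.support_subset_singleton.1 fun p hp => ?_)
      have h1 := (hm p hp).2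
      have h2 := List.length_eq_zero_iff.1 (Nat.le_zero.1 (hmaxm p hp))
      rw [Finset.mem_singleton]
      exact Prod.ext h2 h1
    refine listDegree_eq_coe hle (p := (l', x)) ?_ (by simp)
    rw [hsum, hm', Finsupp.sum_single_index (by simp), Finsupp.smul_apply]
    have : (n.sum fun q s => s • listEnd c R [] (listElt R q.1 q.2)) = n := by
      conv_rhs => rw [← Finsupp.sum_single n]
      refine Finsupp.sum_congr fun q hq => ?_
      rw [single_eq_smul_listElt]
      rfl
    rw [this]
    exact mul_ne_zero hp hq
  · rw [List.concat_eq_append] at *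
    cases l' with
    | nil =>
      have hxv : x = v' := (hn _ (Finsupp.mem_support_iff.2 hq)).2
      subst hxv
      have hn' : n = Finsupp.single ([], x) (n ([], x)) := by
        refine (Finsupp.support_subset_singleton.1 fun p hp => ?_)
        have h2 : p.1 = [] := List.length_eq_zero_iff.1 (Nat.le_zero.1 (hmaxn p hp))
        have h1 := (hn p hp).2
        rw [Finset.mem_singleton]
        rw [h2] at h1
        exact Prod.ext h2 h1
      refine listDegree_eq_coe hle (p := (P ++ [y], x)) ?_ (by simp)
      rw [hsum, Finsupp.sum_apply]
      have : ∀ p ∈ m.support, (m p • n.sum fun q s => s • listEnd c R p.1 (listElt R q.1 q.2))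
          (P ++ [y], x) = if p = (P ++ [y], x) then m p * n ([], x) else 0 := by
        rintro ⟨l, x'⟩ hp
        obtain ⟨h1, rfl⟩ := hm _ hp
        rw [hn', Finsupp.sum_single_index (by simp), listEnd_listElt (by simpa using h1)]
        simp [listElt_apply]
      rw [Finsupp.sum, Finset.sum_congr rfl this, Finset.sum_ite_eq',
        if_pos (Finsupp.mem_support_iff.2 hp)]
      exact mul_ne_zero hp hq
    | cons z Q =>
      obtain ⟨z₁, z₂, h⟩ := exists_actToFree_apply_ne_zero hE (P := P) (Q := Q)
        (fun p hp => ⟨(hm p hp).1, (hm p hp).2, by simpa using hmaxm p hp⟩)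
        (fun q hq => ⟨(hn q hq).1, (hn q hq).2, by simpa using hmaxn q hq⟩) hp hq
      exact listDegree_eq_coe hle h (by simp; omega)

/-! ### The local valuation -/

/-- Acting on the trivial path at `x` keeps exactly the lists with range `x`. With its mirror image
below, this puts both factors into the form required by `listDegree_actToFree`. -/
lemma exists_listLPA_eq_mul_vertexLPA (c : E.SpecialEdges) (a : E.LPA R) (x : V) :
    ∃ m : E.ListModule R, (∀ p ∈ m.support, NormalList c p.1 p.2 ∧ p.2 = x) ∧
      listLPA R m = a * E.vertexLPA R x := by
  obtain ⟨m, hm, rfl⟩ := exists_listLPA_eq c a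
  have hx : listElt R [] x ∈ normalSubmodule c R ⊤ := listElt_mem_normalSubmodule trivial le_top
  have h1 : actToFree c (listElt R [] x) m ∈ Finsupp.supported R R {p | p.2 = x} := by
    refine map_mem_of_normalSubmodule _ _ ⊤ (fun l y hl _ => ?_) hm
    rw [actToFree_listElt hl]
    split_ifs with h
    · obtain rfl : x = y := h
      rw [listEnd_listElt (by simpa using hl), List.append_nil]
      exact Finsupp.single_mem_supported R 1 rfl
    · exact zero_mem _
  have h2 : actToFree c (listElt R [] x) m ∈ normalSubmodule c R ⊤ := act_mem _ hx
  refine ⟨_, fun p hp => ⟨mem_normalSubmodule_top.1 h2 p hp, h1 hp⟩, ?_⟩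
  exact (toLPAHom_mul_listLPA _ hx).symm.trans (congrArg _ (listLPA_nil x))

lemma exists_listLPA_eq_vertexLPA_mul (c : E.SpecialEdges) (b : E.LPA R) (x : V) :
    ∃ n : E.ListModule R, (∀ q ∈ n.support, NormalList c q.1 q.2 ∧ listSrc q.1 q.2 = x) ∧
      listLPA R n = E.vertexLPA R x * b := by
  obtain ⟨n, hn, rfl⟩ := exists_listLPA_eq c b
  have h1 : letterEnd c R (.vertex x) n ∈ srcSubmodule E R x :=
    map_mem_of_normalSubmodule _ _ ⊤ (fun l y hl _ => by
      rw [letterEnd_listElt]; exact letterMul_mem_srcSubmodule (.vertex x) hl) hn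
  have h2 : letterEnd c R (.vertex x) n ∈ normalSubmodule c R ⊤ := letterEnd_mem _ hn
  exact ⟨_, fun q hq => ⟨mem_normalSubmodule_top.1 h2 q hq, h1 hq⟩,
    (letterLPA_mul_listLPA_of_mem (.vertex x) hn).symm⟩

lemma isLocalValuation_maxLength [IsDomain R] (hE : E.IsLV) (c : E.SpecialEdges) :
    IsLocalValuation c (fun a : E.LPA R => maxLength c a) where
  eq_bot_iff a := by
    obtain ⟨m, hm, rfl⟩ := exists_listLPA_eq c a
    rw [maxLength_listLPA hm, listDegree_eq_bot_iff]
    exact ⟨fun h => by rw [h, listLPA_zero], eq_zero_of_listLPA_eq_zero hm⟩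
  eq_zero_iff a := by
    obtain ⟨m, hm, rfl⟩ := exists_listLPA_eq c a
    rw [maxLength_listLPA hm, listDegree_eq_zero_iff, supp_listLPA hm, Finset.forall_mem_image]
    refine and_congr (not_congr ⟨fun h => by rw [h, listLPA_zero],
      eq_zero_of_listLPA_eq_zero hm⟩) (forall₂_congr fun p hp => ?_)
    exact (mem_normalSubmodule_top.1 hm p hp).isTrivial_iff.symm
  add_le a b := by
    obtain ⟨m, hm, rfl⟩ := exists_listLPA_eq c a
    obtain ⟨n, hn, rfl⟩ := exists_listLPA_eq c b
    rw [← listLPA_add, maxLength_listLPA hm, maxLength_listLPA hn,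
      maxLength_listLPA (add_mem hm hn)]
    exact listDegree_add_le m n
  mul_eq x a b := by
    rintro ⟨a', rfl⟩ ⟨b', rfl⟩
    obtain ⟨m, hm, hm'⟩ := exists_listLPA_eq_mul_vertexLPA c a' x
    obtain ⟨n, hn, hn'⟩ := exists_listLPA_eq_vertexLPA_mul c b' x
    have hmN := mem_normalSubmodule_top.2 fun p hp => (hm p hp).1
    have hnN := mem_normalSubmodule_top.2 fun p hp => (hn p hp).1
    have h : listLPA R m * listLPA R n = listLPA R (actToFree c n m) :=
      toLPAHom_mul_listLPA (toFree R m) hnN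
    have hmn : actToFree c n m ∈ normalSubmodule c R ⊤ := act_mem _ hnN
    rw [← hm', ← hn', h, maxLength_listLPA hmN, maxLength_listLPA hnN, maxLength_listLPA hmn,
      listDegree_actToFree hE hm hn]

end WeightedGraph

end

theorem mainTheorem5 {V : Type*} {S : Type*} (E : WeightedGraph V S) (hE : E.IsLV)
    (R : Type*) [Ring R] [IsDomain R] (c : E.SpecialEdges) :
    (∀ a : E.LPA R, ∃! f : E.FreeRing R, WeightedGraph.IsNormalRep c a f) ∧
      WeightedGraph.IsLocalValuation c
        (fun a : E.LPA R => WeightedGraph.maxLength c a) :=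
  ⟨WeightedGraph.existsUnique_isNormalRep c, WeightedGraph.isLocalValuation_maxLength hE c⟩
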